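/- Let $d\ge 3$, let $U\subset\mathbb{R}^d$ be a bounded open set, and let $c\in L^{\frac{2d}{d+2}}(U)$ with $c\ge 0$ almost everywhere. Let $H^{1,2}_0(U)$ be the closure of $C_0^\infty(U)$ in the Sobolev space $H^{1,2}(U)$. For $f\in L^1(U)$, a weak solution of the Dirichlet problem $$-\Delta u+cu=f\ \text{ in } U,\qquad u=0\ \text{ on }\partial U \qquad (*)$$ is a function $u\in H^{1,2}_0(U)$ with $cu\in L^1(U)$ and $$\int_U\langle\nabla u,\nabla\varphi\rangle\,dx+\int_U cu\varphi\,dx=\int_U f\varphi\,dx\qquad\text{for all }\varphi\in C_0^\infty(U).$$ Then the following hold. (i) If $v\in H^{1,2}_0(U)$ satisfies $\int_U\langle\nabla v,\nabla\varphi\rangle\,dx+\int_U cv\varphi\,dx=0$ for all $\varphi\in C_0^\infty(U)$, then $v=0$ almost everywhere in $U$. (ii) If $f\in L^{\frac{2d}{d+2}}(U)$, then there exists a weak solution $u\in H^{1,2}_0(U)$ of $(*)$ such that $$\|\nabla u\|_{L^2(U)}\le\frac{2(d-1)}{d-2}\,\|f\|_{L^{\frac{2d}{d+2}}(U)}.$$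 (iii) If $f\in L^{\frac{\hat p d}{d+\hat p}}(U)$ for some $\hat p\in(d,\infty)$, then $(*)$ has a unique weak solution $u$; it satisfies the estimate in (ii), belongs to $L^\infty(U)$, and $$\|u\|_{L^\infty(U)}\le C\,\|f\|_{L^{\frac{\hat p d}{d+\hat p}}(U)},$$ where $C>0$ is a constant depending only on $d$, $\hat p$ and $|U|$ (the Lebesgue measure of $U$). -/

import Mathlib

open MeasureTheory Filter Topology
open scoped ContDiff ENNReal

/-- `φ ∈ C₀^∞(U)`: a smooth function whose support is a compact subset of `U` (extended by zero
outside `U`). -/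
def IsTestFunction {d : ℕ} (U : Set (EuclideanSpace ℝ (Fin d)))
    (φ : EuclideanSpace ℝ (Fin d) → ℝ) : Prop :=
  ContDiff ℝ ∞ φ ∧ HasCompactSupport φ ∧ tsupport φ ⊆ U

/-- `g = (∂₁u, …, ∂_d u)` on `U` in the sense of weak derivatives; `u` and `g` are only required to
be locally integrable on `U`. -/
def IsWeakGradient {d : ℕ} (U : Set (EuclideanSpace ℝ (Fin d)))
    (u : EuclideanSpace ℝ (Fin d) → ℝ)
    (g : EuclideanSpace ℝ (Fin d) → EuclideanSpace ℝ (Fin d)) : Prop :=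
  LocallyIntegrableOn u U volume ∧ LocallyIntegrableOn g U volume ∧
    ∀ φ : EuclideanSpace ℝ (Fin d) → ℝ, IsTestFunction U φ → ∀ i : Fin d,
      ∫ x in U, u x * fderiv ℝ φ x (EuclideanSpace.single i 1) = - ∫ x in U, g x i * φ x

open Classical in
/-- A representative of the weak gradient `∇u` on `U`, where it exists (and `0` otherwise). By
`weakGradient_ae_eq` it is determined almost everywhere on `U`. -/
noncomputable def weakGradient {d : ℕ} (U : Set (EuclideanSpace ℝ (Fin d)))
    (u : EuclideanSpace ℝ (Fin d) → ℝ) :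
    EuclideanSpace ℝ (Fin d) → EuclideanSpace ℝ (Fin d) :=
  if h : ∃ g, IsWeakGradient U u g then h.choose else 0

theorem isWeakGradient_weakGradient {d : ℕ} {U : Set (EuclideanSpace ℝ (Fin d))}
    {u : EuclideanSpace ℝ (Fin d) → ℝ}
    {g : EuclideanSpace ℝ (Fin d) → EuclideanSpace ℝ (Fin d)}
    (h : IsWeakGradient U u g) : IsWeakGradient U u (weakGradient U u) := by
  have h' : ∃ g, IsWeakGradient U u g := ⟨g, h⟩
  rw [weakGradient, dif_pos h']
  exact h'.choose_spec

/-- Weak gradients are unique almost everywhere. -/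
theorem weakGradient_ae_eq {d : ℕ} {U : Set (EuclideanSpace ℝ (Fin d))} (hU : IsOpen U)
    {u : EuclideanSpace ℝ (Fin d) → ℝ}
    {g : EuclideanSpace ℝ (Fin d) → EuclideanSpace ℝ (Fin d)}
    (h : IsWeakGradient U u g) : weakGradient U u =ᵐ[volume.restrict U] g := by
  obtain ⟨-, hg', h1⟩ := isWeakGradient_weakGradient h
  obtain ⟨-, hg, h2⟩ := h
  have key : ∀ i : Fin d, ∀ᵐ x ∂(volume : Measure (EuclideanSpace ℝ (Fin d))), x ∈ U →
      weakGradient U u x i - g x i = 0 := by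
    intro i
    have comp : ∀ {k : EuclideanSpace ℝ (Fin d) → EuclideanSpace ℝ (Fin d)},
        LocallyIntegrableOn k U volume → LocallyIntegrableOn (fun x => k x i) U volume := by
      intro k hk x hx
      obtain ⟨s, hs, hi⟩ := hk x hx
      exact ⟨s, hs, (EuclideanSpace.proj (𝕜 := ℝ) i).integrable_comp hi⟩
    refine hU.ae_eq_zero_of_integral_contDiff_smul_eq_zero
      ((comp hg').sub (comp hg)) ?_
    intro φ hφ hc hs
    have e := (h1 φ ⟨hφ, hc, hs⟩ i).symm.trans (h2 φ ⟨hφ, hc, hs⟩ i)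
    have int : ∀ {k : EuclideanSpace ℝ (Fin d) → ℝ}, LocallyIntegrableOn k U volume →
        IntegrableOn (fun x => k x * φ x) U volume := by
      intro k hk
      have hK : IntegrableOn k (tsupport φ) volume :=
        hk.integrableOn_compact_subset hs hc
      have := hK.mul_continuousOn hφ.continuous.continuousOn hc
      refine IntegrableOn.of_forall_sdiff_eq_zero this hU.measurableSet ?_
      intro x hx
      simp [image_eq_zero_of_notMem_tsupport hx.2]
    have e2 : ∫ x, φ x • (weakGradient U u x i - g x i)
        = ∫ x in U, φ x • (weakGradient U u x i - g x i) := by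
      refine (setIntegral_eq_integral_of_forall_compl_eq_zero ?_).symm
      intro x hx
      simp [image_eq_zero_of_notMem_tsupport (fun hh => hx (hs hh))]
    have e3 : ∫ x in U, φ x • (weakGradient U u x i - g x i)
        = ∫ x in U, (weakGradient U u x i * φ x - g x i * φ x) := by
      congr 1; ext x; simp only [smul_eq_mul]; ring
    change ∫ x, φ x • (weakGradient U u x i - g x i) = 0
    rw [e2, e3, integral_sub (int (comp hg')) (int (comp hg))]
    linarith
  rw [EventuallyEq, ae_restrict_iff' hU.measurableSet]
  filter_upwards [ae_all_iff.2 key] with x hx hxU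
  ext i
  exact sub_eq_zero.1 (hx i hxU)

/-- `u ∈ H^{1,2}(U)`. -/
def MemH1 {d : ℕ} (U : Set (EuclideanSpace ℝ (Fin d)))
    (u : EuclideanSpace ℝ (Fin d) → ℝ) : Prop :=
  MemLp u 2 (volume.restrict U) ∧
    ∃ g, IsWeakGradient U u g ∧ MemLp g 2 (volume.restrict U)

/-- `u ∈ H^{1,2}_0(U)`: `u` lies in the closure of `C₀^∞(U)` in `H^{1,2}(U)`. -/
def MemH10 {d : ℕ} (U : Set (EuclideanSpace ℝ (Fin d)))
    (u : EuclideanSpace ℝ (Fin d) → ℝ) : Prop :=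
  MemH1 U u ∧
    ∃ φ : ℕ → EuclideanSpace ℝ (Fin d) → ℝ, (∀ n, IsTestFunction U (φ n)) ∧
      Tendsto (fun n => eLpNorm (fun x => φ n x - u x) 2 (volume.restrict U)) atTop (𝓝 0) ∧
      Tendsto (fun n => eLpNorm (fun x => gradient (φ n) x - weakGradient U u x) 2
        (volume.restrict U)) atTop (𝓝 0)

/-- `u` is a weak solution of `-Δu + c u = f` in `U`, `u = 0` on `∂U`. The integrability of `c u`
and `f` makes all the integrals well defined. -/
def IsWeakSolution {d : ℕ} (U : Set (EuclideanSpace ℝ (Fin d)))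
    (c f u : EuclideanSpace ℝ (Fin d) → ℝ) : Prop :=
  MemH10 U u ∧ IntegrableOn (fun x => c x * u x) U volume ∧ IntegrableOn f U volume ∧
    ∀ φ : EuclideanSpace ℝ (Fin d) → ℝ, IsTestFunction U φ →
      (∫ x in U, inner ℝ (weakGradient U u x) (gradient φ x)) + ∫ x in U, c x * u x * φ x
        = ∫ x in U, f x * φ x

/-! Everything rests on the Sobolev inequality with the explicit constant γ = 2(d-1)/(d-2). It
controls u in the exponent 2d/(d-2), which is conjugate to 2d/(d+2), so `c * u` is integrable and φ
↦ ∫ f φ is bounded by the gradient norm of φ.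

Since `c * u` is only in L¹, u itself need not be admissible as a test function. But g(u) is, for g
smooth, bounded, with bounded derivative and g(0) = 0 (`MemH10.integral_comp_eq`). If moreover s
g(s) ≥ 0, the term ∫ c u g(u) is nonnegative and can be dropped, which is why no bound depends on c.
With g = arctan and f = 0 this forces ∇v = 0, hence v = 0 by Sobolev: this is (i), and uniqueness
follows by taking differences.

For existence, the map φ ↦ (∇φ, √c φ) embeds C₀^∞(U) isometrically for the energy form into L² × L²,
and Riesz representation on the closure of its range gives the solution (`exists_tendsto_inner_eq`).
The functional is dominated by the first component alone, whence the gradient estimate with constant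
γ.

For the L^∞ bound, g is a smooth truncation above level k of width δ. Energy identity, Hölder,
Sobolev and Chebyshev give a(k+δ) ≤ (K/δ)^σ a(k)^β for a(k) = |{|u| > k}|, with β > 1 because p > d.
Stampacchia's lemma then makes a vanish at a finite level proportional to the norm of f. -/

section Sobolev

/-! ### Sobolev inequality with explicit constant -/

open Function Set

/-- The **Gagliardo–Nirenberg–Sobolev inequality** on Euclidean space, for `p = 1`, with
constant `1` with respect to the Euclidean norm of the gradient. -/
theorem lintegral_rpow_le_rpow_lintegral_fderiv_euclidean {d : ℕ} {p : ℝ}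
    (hp : Real.HolderConjugate d p) {u : EuclideanSpace ℝ (Fin d) → ℝ} (hu : ContDiff ℝ 1 u)
    (h2u : HasCompactSupport u) :
    ∫⁻ x, ‖u x‖ₑ ^ p ≤ (∫⁻ x, ‖fderiv ℝ u x‖ₑ) ^ p := by
  have hp' : Real.HolderConjugate (Fintype.card (Fin d)) p := by simpa using hp
  have hcont := hu.continuous
  have hcont' := hu.continuous_fderiv one_ne_zero
  have hmp := PiLp.volume_preserving_toLp (Fin d)
  have hd1 : (1 : ℝ) ≤ (d : ℝ) - 1 := by
    have : (2 : ℝ) ≤ d := by exact_mod_cast hp.lt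
    linarith
  let T : (Fin d → ℝ) → EuclideanSpace ℝ (Fin d) := WithLp.toLp 2
  have hTc : ContDiff ℝ 1 T := PiLp.contDiff_toLp
  have hTe : IsClosedEmbedding T :=
    (PiLp.homeomorph 2 (fun _ : Fin d => ℝ)).symm.isClosedEmbedding
  rw [← hmp.lintegral_comp (by fun_prop), ← hmp.lintegral_comp (by fun_prop)]
  -- As p = d/(d-1), |u|^p is a product of d equal factors. The i-th is bounded by an integral along
  -- the i-th coordinate line, and the grid-lines lemma integrates the product.
  calc ∫⁻ x, ‖u (T x)‖ₑ ^ p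
      = ∫⁻ x, ∏ _i : Fin d, ‖u (T x)‖ₑ ^ (1 / ((Fintype.card (Fin d) : ℝ) - 1)) := by
        congr! 2 with x
        rw [Finset.prod_const, Finset.card_univ, Fintype.card_fin, ← ENNReal.rpow_natCast,
          ← ENNReal.rpow_mul, hp.conjugate_eq]
        field_simp
    _ ≤ ∫⁻ x, ∏ i, (∫⁻ xᵢ, ‖fderiv ℝ u (T (update x i xᵢ))‖ₑ) ^
          ((1 : ℝ) / ((Fintype.card (Fin d) : ℝ) - 1)) := ?_
    _ ≤ (∫⁻ x, ‖fderiv ℝ u (T x)‖ₑ) ^ p :=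
        lintegral_prod_lintegral_pow_le (fun _ => volume) hp'
          (f := fun x => ‖fderiv ℝ u (T x)‖ₑ) (by fun_prop)
  have hd2 : (0 : ℝ) ≤ 1 / ((Fintype.card (Fin d) : ℝ) - 1) := by
    rw [Fintype.card_fin]; positivity
  refine lintegral_mono fun x => Finset.prod_le_prod' fun i _ => ?_
  refine ENNReal.rpow_le_rpow ?_ hd2
  have hupd : ContDiff ℝ 1 (fun y : ℝ => T (update x i y)) :=
    hTc.comp (contDiff_update 1 x i)
  calc ‖u (T x)‖ₑ
    _ ≤ ∫⁻ y in Iic (x i), ‖deriv (fun y => u (T (update x i y))) y‖ₑ := by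
        refine le_trans (by simp)
          (HasCompactSupport.enorm_le_lintegral_Ici_deriv (hu.comp hupd) ?_ (x i))
        exact h2u.comp_isClosedEmbedding (hTe.comp (isClosedEmbedding_update x i))
    _ ≤ ∫⁻ y, ‖fderiv ℝ u (T (update x i y))‖ₑ := ?_
  refine lintegral_mono' Measure.restrict_le_self fun y => ?_
  have hder : HasDerivAt (fun y : ℝ => T (update x i y)) (T (Pi.single i 1)) y :=
    ((PiLp.continuousLinearEquiv 2 ℝ (fun _ : Fin d => ℝ)).symm.hasFDerivAt.comp_hasDerivAt y
      (hasDerivAt_update x i y))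
  have h2 := ((hu.differentiable one_ne_zero) (T (update x i y))).hasFDerivAt.comp_hasDerivAt y hder
  have h3 : deriv (fun y => u (T (update x i y))) y
      = fderiv ℝ u (T (update x i y)) (T (Pi.single i 1)) := h2.deriv
  rw [h3]
  refine (ContinuousLinearMap.le_opENorm _ _).trans ?_
  -- A coordinate direction has Euclidean length one, so the constant stays 1.
  have : ‖T (Pi.single i (1 : ℝ))‖ₑ = 1 := by
    have h4 : T (Pi.single i (1 : ℝ)) = EuclideanSpace.single i 1 := rfl
    rw [h4, enorm_eq_nnnorm]; simp
  rw [this, mul_one]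

/-- The **Sobolev inequality** `‖u‖_{2d/(d-2)} ≤ 2(d-1)/(d-2) ‖∇u‖₂`. -/
theorem eLpNorm_le_eLpNorm_gradient {d : ℕ} (hd : 3 ≤ d) {u : EuclideanSpace ℝ (Fin d) → ℝ}
    (hu : ContDiff ℝ 1 u) (h2u : HasCompactSupport u) :
    eLpNorm u (ENNReal.ofReal (2 * d / (d - 2))) volume ≤
      ENNReal.ofReal (2 * (d - 1) / (d - 2)) * eLpNorm (gradient u) 2 volume := by
  have hd3 : (3 : ℝ) ≤ d := by exact_mod_cast hd
  have hd2 : (0 : ℝ) < d - 2 := by linarith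
  set s : ℝ := 2 * d / (d - 2) with hs
  -- The case p = 1 will be applied to |u|^γ. This γ satisfies both γ n' = s and 2(γ-1) = s, so
  -- after Cauchy–Schwarz the same integral I appears on both sides.
  set γ : ℝ := 2 * (d - 1) / (d - 2) with hγ
  set n' : ℝ := d / (d - 1) with hn'
  have hd1 : (0 : ℝ) < d - 1 := by linarith
  have hs0 : 0 < s := by positivity
  have hγ0 : 0 < γ := by positivity
  have hγ1 : 1 < γ := by rw [hγ, one_lt_div hd2]; linarith
  have hn0 : 0 < n' := by positivity
  have hp : Real.HolderConjugate d n' := by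
    rw [Real.holderConjugate_iff]
    refine ⟨by linarith, ?_⟩
    rw [hn']; field_simp; ring
  have e1 : γ * n' = s := by rw [hγ, hn', hs]; field_simp
  have e2 : (γ - 1) * 2 = s := by rw [hγ, hs]; field_simp; ring
  have e3 : 1 / n' - 1 / 2 = 1 / s := by rw [hn', hs]; field_simp; ring
  have hgrad : eLpNorm (gradient u) 2 volume = eLpNorm (fderiv ℝ u) 2 volume := by
    refine eLpNorm_congr_enorm_ae (Eventually.of_forall fun x => ?_)
    simp only [gradient, enorm_eq_nnnorm]
    congr 1
    exact (InnerProductSpace.toDual ℝ (EuclideanSpace ℝ (Fin d))).symm.nnnorm_map _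
  have hcont := hu.continuous
  have hcont' := hu.continuous_fderiv one_ne_zero
  rw [hgrad, eLpNorm_eq_lintegral_rpow_enorm_toReal (by positivity) ENNReal.ofReal_ne_top,
    eLpNorm_eq_lintegral_rpow_enorm_toReal two_ne_zero ENNReal.ofNat_ne_top,
    ENNReal.toReal_ofReal hs0.le, ENNReal.toReal_ofNat]
  set I := ∫⁻ x, ‖u x‖ₑ ^ s with hI
  set J := ∫⁻ x, ‖fderiv ℝ u x‖ₑ ^ (2 : ℝ) with hJ
  by_cases hI0 : I = 0
  · rw [hI0, ENNReal.zero_rpow_of_pos (by positivity)]; exact zero_le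
  have hIt : I ≠ ⊤ := by
    have h := (hcont.memLp_of_hasCompactSupport (μ := volume) h2u
      (p := ENNReal.ofReal s)).eLpNorm_lt_top
    rw [eLpNorm_lt_top_iff_lintegral_rpow_enorm_lt_top (by positivity) ENNReal.ofReal_ne_top,
      ENNReal.toReal_ofReal hs0.le] at h
    exact h.ne
  let v : EuclideanSpace ℝ (Fin d) → ℝ := fun x ↦ ‖u x‖ ^ γ
  have hv : ContDiff ℝ 1 v := hu.norm_rpow hγ1
  have h2v : HasCompactSupport v := h2u.norm.rpow_const hγ0.ne'
  have key : I ^ (1 / n') ≤ ENNReal.ofReal γ * (I ^ (1 / 2 : ℝ) * J ^ (1 / 2 : ℝ)) :=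
    calc I ^ (1 / n') = (∫⁻ x, ‖v x‖ₑ ^ n') ^ (1 / n') := by
          simp (discharger := positivity) [v, hI, ← e1, Real.enorm_rpow_of_nonneg,
            ENNReal.rpow_mul]
      _ ≤ ((∫⁻ x, ‖fderiv ℝ v x‖ₑ) ^ n') ^ (1 / n') := by
          gcongr
          exact lintegral_rpow_le_rpow_lintegral_fderiv_euclidean hp hv h2v
      _ = ∫⁻ x, ‖fderiv ℝ v x‖ₑ := by
          rw [← ENNReal.rpow_mul, mul_one_div_cancel hn0.ne', ENNReal.rpow_one]
      _ ≤ ∫⁻ x, ENNReal.ofReal γ * (‖u x‖ₑ ^ (γ - 1) * ‖fderiv ℝ u x‖ₑ) := by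
          refine lintegral_mono fun x => ?_
          have := enorm_fderiv_norm_rpow_le (p := ⟨γ, hγ0.le⟩) (x := x)
            (hu.differentiable one_ne_zero) hγ1
          refine this.trans_eq ?_
          rw [ENNReal.ofReal_eq_coe_nnreal hγ0.le, ← mul_assoc]
          rfl
      _ = ENNReal.ofReal γ * ∫⁻ x, ‖u x‖ₑ ^ (γ - 1) * ‖fderiv ℝ u x‖ₑ :=
          lintegral_const_mul _ (by fun_prop)
      _ ≤ _ := by
          gcongr
          have := ENNReal.lintegral_mul_le_Lp_mul_Lq (f := fun x => ‖u x‖ₑ ^ (γ - 1))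
            (g := fun x => ‖fderiv ℝ u x‖ₑ) volume Real.HolderConjugate.two_two
            (by fun_prop) (by fun_prop)
          simp only [← ENNReal.rpow_mul, e2] at this
          exact this
  have hI2 : I ^ (1 / 2 : ℝ) ≠ 0 := by
    simp [hI0, hIt]
  have hI2t : I ^ (1 / 2 : ℝ) ≠ ⊤ := ENNReal.rpow_ne_top_of_nonneg (by norm_num) hIt
  -- Absorb I^(1/2) into the left side, which needs 0 < I < ∞; the remaining exponent is 1/n' - 1/2
  -- = 1/s.
  rw [← e3, ENNReal.rpow_sub _ _ hI0 hIt]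
  refine ENNReal.div_le_of_le_mul ?_
  calc _ ≤ _ := key
    _ = _ := by ring

end Sobolev

/-! ### Limits in L² -/

section SquareIntegrable

variable {α V : Type*} [MeasurableSpace α] {μ : Measure α} [NormedAddCommGroup V]

theorem tendsto_integral_inner_of_tendsto_eLpNorm [InnerProductSpace ℝ V] {W F : α → V}
    {Fn : ℕ → α → V} (hW : MemLp W 2 μ) (hFn : ∀ n, MemLp (Fn n) 2 μ) (hF : MemLp F 2 μ)
    (h : Tendsto (fun n => eLpNorm (fun x => Fn n x - F x) 2 μ) atTop (𝓝 0)) :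
    Tendsto (fun n => ∫ x, inner ℝ (W x) (Fn n x) ∂μ) atTop (𝓝 (∫ x, inner ℝ (W x) (F x) ∂μ)) := by
  have h1 : Tendsto (fun n => (hFn n).toLp (Fn n)) atTop (𝓝 (hF.toLp F)) :=
    (Lp.tendsto_Lp_iff_tendsto_eLpNorm'' Fn hFn F hF).2 h
  have h2 := (tendsto_const_nhds (x := hW.toLp W)).inner h1 (𝕜 := ℝ)
  have e : ∀ {G : α → V} (hG : MemLp G 2 μ),
      inner ℝ (hW.toLp W) (hG.toLp G) = ∫ x, inner ℝ (W x) (G x) ∂μ := fun hG => by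
    rw [L2.inner_def]
    refine integral_congr_ae ?_
    filter_upwards [hW.coeFn_toLp, hG.coeFn_toLp] with x h1 h2
    rw [h1, h2]
  simpa only [e] using h2

theorem integrable_inner_of_memLp_two [InnerProductSpace ℝ V] {F G : α → V} (hF : MemLp F 2 μ)
    (hG : MemLp G 2 μ) : Integrable (fun x => inner ℝ (F x) (G x)) μ :=
  (hF.norm.integrable_mul hG.norm).mono' (hF.1.inner hG.1)
    (Eventually.of_forall fun x => norm_inner_le_norm (F x) (G x))

/-- Dominated convergence in `L²`, for a bounded sequence of scalar multipliers. -/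
theorem tendsto_eLpNorm_sub_smul_of_bounded [NormedSpace ℝ V] {W : α → V} {b : ℕ → α → ℝ}
    {b' : α → ℝ} {M : ℝ} (hW : MemLp W 2 μ) (hb : ∀ n, AEStronglyMeasurable (b n) μ)
    (hbM : ∀ n x, |b n x| ≤ M) (hlim : ∀ᵐ x ∂μ, Tendsto (fun n => b n x) atTop (𝓝 (b' x))) :
    Tendsto (fun n => eLpNorm (fun x => (b n x - b' x) • W x) 2 μ) atTop (𝓝 0) := by
  have hb' : AEStronglyMeasurable b' μ := aestronglyMeasurable_of_tendsto_ae atTop hb hlim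
  have hM : ∀ᵐ x ∂μ, |b' x| ≤ M := by
    filter_upwards [hlim] with x hx
    exact le_of_tendsto hx.abs (Eventually.of_forall fun n => hbM n x)
  have key : Tendsto (fun n => ∫⁻ x, ‖(b n x - b' x) • W x‖ₑ ^ (2 : ℝ) ∂μ) atTop
      (𝓝 (∫⁻ _, 0 ∂μ)) := by
    refine tendsto_lintegral_of_dominated_convergence'
      (fun x => ENNReal.ofReal (2 * M) ^ (2 : ℝ) * ‖W x‖ₑ ^ (2 : ℝ)) ?_ ?_ ?_ ?_
    · intro n
      exact ((((hb n).sub hb').smul hW.1).enorm).pow_const _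
    · intro n
      filter_upwards [hM] with x hx
      rw [enorm_smul, ← ENNReal.mul_rpow_of_nonneg _ _ (by norm_num)]
      gcongr
      rw [Real.enorm_eq_ofReal_abs]
      refine ENNReal.ofReal_le_ofReal ((abs_sub _ _).trans ?_)
      linarith [hbM n x]
    · rw [lintegral_const_mul'' _ (hW.1.enorm.pow_const _)]
      refine ENNReal.mul_ne_top (by finiteness) ?_
      have := lintegral_rpow_enorm_lt_top_of_eLpNorm_lt_top two_ne_zero ENNReal.ofNat_ne_top hW.2
      simpa using this.ne
    · filter_upwards [hlim] with x hx
      have h1 : Tendsto (fun n => (b n x - b' x) • W x) atTop (𝓝 0) := by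
        simpa using (hx.sub_const (b' x)).smul_const (W x)
      have h2 := (ENNReal.continuous_rpow_const (y := 2)).tendsto _ |>.comp h1.enorm
      simpa [Function.comp_def] using h2
  have h3 := (ENNReal.continuous_rpow_const (y := 1 / 2)).tendsto _ |>.comp key
  simp only [lintegral_zero] at h3
  rw [ENNReal.zero_rpow_of_pos (by norm_num)] at h3
  refine h3.congr fun n => ?_
  rw [eLpNorm_eq_lintegral_rpow_enorm_toReal two_ne_zero ENNReal.ofNat_ne_top]
  simp

end SquareIntegrable

/-! ### Test functions and their limits in H^{1,2}_0 -/

section TestFunctions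

variable {d : ℕ} {U : Set (EuclideanSpace ℝ (Fin d))}

local notation "𝔼" => EuclideanSpace ℝ (Fin d)

theorem ContDiff.continuous_gradient {φ : 𝔼 → ℝ} (h : ContDiff ℝ 1 φ) :
    Continuous (gradient φ) :=
  (InnerProductSpace.toDual ℝ 𝔼).symm.continuous.comp (h.continuous_fderiv one_ne_zero)

theorem support_gradient_subset (φ : 𝔼 → ℝ) :
    Function.support (gradient φ) ⊆ tsupport φ := by
  intro x hx
  refine support_fderiv_subset ℝ (f := φ) fun h0 => hx ?_
  simp [gradient, h0]

theorem gradient_apply (φ : 𝔼 → ℝ) (x : 𝔼) (i : Fin d) :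
    gradient φ x i = fderiv ℝ φ x (EuclideanSpace.single i 1) := by
  have h : inner ℝ (gradient φ x) (EuclideanSpace.single i 1)
      = fderiv ℝ φ x (EuclideanSpace.single i 1) := by
    rw [gradient, InnerProductSpace.toDual_symm_apply]
  rw [← h, EuclideanSpace.inner_single_right]
  simp

namespace IsTestFunction

theorem contDiff_one {φ : 𝔼 → ℝ} (h : IsTestFunction U φ) : ContDiff ℝ 1 φ :=
  h.1.of_le (by exact_mod_cast le_top)

theorem continuous {φ : 𝔼 → ℝ} (h : IsTestFunction U φ) : Continuous φ := h.1.continuous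

theorem continuous_gradient {φ : 𝔼 → ℝ} (h : IsTestFunction U φ) : Continuous (gradient φ) :=
  h.contDiff_one.continuous_gradient

theorem hasCompactSupport_gradient {φ : 𝔼 → ℝ} (h : IsTestFunction U φ) :
    HasCompactSupport (gradient φ) :=
  h.2.1.mono' (support_gradient_subset φ)

theorem memLp {φ : 𝔼 → ℝ} (h : IsTestFunction U φ) (p : ℝ≥0∞) :
    MemLp φ p (volume.restrict U) :=
  (h.continuous.memLp_of_hasCompactSupport h.2.1).restrict U

theorem memLp_gradient {φ : 𝔼 → ℝ} (h : IsTestFunction U φ) (p : ℝ≥0∞) :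
    MemLp (gradient φ) p (volume.restrict U) :=
  (h.continuous_gradient.memLp_of_hasCompactSupport h.hasCompactSupport_gradient).restrict U

theorem exists_bound {φ : 𝔼 → ℝ} (h : IsTestFunction U φ) : ∃ B, ∀ x, |φ x| ≤ B :=
  h.2.1.exists_bound_of_continuous h.continuous

theorem zero : IsTestFunction U (0 : 𝔼 → ℝ) :=
  ⟨contDiff_const, HasCompactSupport.zero, by simp [tsupport]⟩

theorem add {φ ψ : 𝔼 → ℝ} (h : IsTestFunction U φ) (h' : IsTestFunction U ψ) :
    IsTestFunction U (φ + ψ) :=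
  ⟨h.1.add h'.1, h.2.1.add h'.2.1, (tsupport_add φ ψ).trans (Set.union_subset h.2.2 h'.2.2)⟩

theorem smul (a : ℝ) {φ : 𝔼 → ℝ} (h : IsTestFunction U φ) : IsTestFunction U (a • φ) :=
  ⟨h.1.const_smul a, h.2.1.smul_left (f := fun _ => a),
    (tsupport_smul_subset_right (fun _ => a) φ).trans h.2.2⟩

theorem comp {φ : 𝔼 → ℝ} (h : IsTestFunction U φ) {g : ℝ → ℝ} (hg : ContDiff ℝ ∞ g)
    (g0 : g 0 = 0) : IsTestFunction U (fun x => g (φ x)) :=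
  ⟨hg.comp h.1, h.2.1.comp_left g0, (tsupport_comp_subset g0 φ).trans h.2.2⟩

theorem gradient_comp {φ : 𝔼 → ℝ} (h : IsTestFunction U φ) {g : ℝ → ℝ} (hg : ContDiff ℝ ∞ g)
    (x : 𝔼) : gradient (fun x => g (φ x)) x = deriv g (φ x) • gradient φ x := by
  have h1 : HasDerivAt g (deriv g (φ x)) (φ x) :=
    (hg.differentiable (by simp) _).hasDerivAt
  have h2 := h1.comp_hasFDerivAt x (h.1.differentiable (by simp) x).hasFDerivAt
  have h3 : fderiv ℝ (fun x => g (φ x)) x = deriv g (φ x) • fderiv ℝ φ x := h2.fderiv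
  simp [gradient, h3]

/-- Integration by parts without boundary term. It is the identity that passes to the limit in
`memH10_of_tendsto`. -/
theorem integral_mul_fderiv {φ ψ : 𝔼 → ℝ} (hφ : IsTestFunction U φ) (hψ : IsTestFunction U ψ)
    (i : Fin d) : ∫ x in U, φ x * fderiv ℝ ψ x (EuclideanSpace.single i 1)
      = - ∫ x in U, gradient φ x i * ψ x := by
  have z1 : ∀ x, x ∉ U → φ x = 0 := fun x hx =>
    image_eq_zero_of_notMem_tsupport fun h => hx (hφ.2.2 h)
  have z2 : ∀ x, x ∉ U → ψ x = 0 := fun x hx =>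
    image_eq_zero_of_notMem_tsupport fun h => hx (hψ.2.2 h)
  rw [setIntegral_eq_integral_of_forall_compl_eq_zero fun x hx => by simp [z1 x hx],
    setIntegral_eq_integral_of_forall_compl_eq_zero fun x hx => by simp [z2 x hx]]
  simp_rw [gradient_apply]
  have c1 : Continuous fun x => fderiv ℝ φ x (EuclideanSpace.single i 1) :=
    (hφ.contDiff_one.continuous_fderiv one_ne_zero).clm_apply continuous_const
  have c2 : Continuous fun x => fderiv ℝ ψ x (EuclideanSpace.single i 1) :=
    (hψ.contDiff_one.continuous_fderiv one_ne_zero).clm_apply continuous_const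
  refine integral_mul_fderiv_eq_neg_fderiv_mul_of_integrable ?_ ?_ ?_ ?_ ?_
  · exact (c1.mul hψ.continuous).integrable_of_hasCompactSupport hψ.2.1.mul_left
  · exact (hφ.continuous.mul c2).integrable_of_hasCompactSupport hφ.2.1.mul_right
  · exact (hφ.continuous.mul hψ.continuous).integrable_of_hasCompactSupport hφ.2.1.mul_right
  · exact fun x _ => hφ.1.differentiable (by simp) x
  · exact fun x _ => hψ.1.differentiable (by simp) x

/-- The Sobolev inequality for test functions. -/
theorem eLpNorm_le (hd : 3 ≤ d) {φ : 𝔼 → ℝ} (h : IsTestFunction U φ) :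
    eLpNorm φ (ENNReal.ofReal (2 * d / (d - 2))) (volume.restrict U) ≤
      ENNReal.ofReal (2 * (d - 1) / (d - 2)) * eLpNorm (gradient φ) 2 (volume.restrict U) := by
  have e : eLpNorm (gradient φ) 2 (volume.restrict U) = eLpNorm (gradient φ) 2 volume :=
    eLpNorm_restrict_eq_of_support_subset ((support_gradient_subset φ).trans h.2.2)
  rw [e]
  exact (eLpNorm_mono_measure _ Measure.restrict_le_self).trans
    (eLpNorm_le_eLpNorm_gradient hd h.contDiff_one h.2.1)

end IsTestFunction

/-- A limit in `L²` of test functions whose gradients converge in `L²` lies in `H^{1,2}_0(U)`, and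
its weak gradient is the limit of the gradients. -/
theorem memH10_of_tendsto (hU : IsOpen U) {φ : ℕ → 𝔼 → ℝ} (hφ : ∀ n, IsTestFunction U (φ n))
    {u : 𝔼 → ℝ} {G : 𝔼 → 𝔼} (hu : MemLp u 2 (volume.restrict U))
    (hG : MemLp G 2 (volume.restrict U))
    (h1 : Tendsto (fun n => eLpNorm (fun x => φ n x - u x) 2 (volume.restrict U)) atTop (𝓝 0))
    (h2 : Tendsto (fun n => eLpNorm (fun x => gradient (φ n) x - G x) 2
      (volume.restrict U)) atTop (𝓝 0)) :
    MemH10 U u ∧ weakGradient U u =ᵐ[volume.restrict U] G := by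
  have hwg : IsWeakGradient U u G := by
    refine ⟨locallyIntegrableOn_of_locallyIntegrable_restrict (hu.locallyIntegrable (by norm_num)),
      locallyIntegrableOn_of_locallyIntegrable_restrict (hG.locallyIntegrable (by norm_num)), ?_⟩
    intro ψ hψ i
    have hD : MemLp (fun x => fderiv ℝ ψ x (EuclideanSpace.single i 1)) 2
        (volume.restrict U) := by
      have := (EuclideanSpace.proj (𝕜 := ℝ) i).comp_memLp' (hψ.memLp_gradient 2)
      simpa [Function.comp_def, gradient_apply] using this
    have t1 := tendsto_integral_inner_of_tendsto_eLpNorm hD (fun n => (hφ n).memLp 2) hu h1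
    -- Pairing with the vector field ψ eᵢ extracts the i-th component of the gradients as an L²
    -- inner product.
    have hP : MemLp (fun x => EuclideanSpace.single i (ψ x)) 2 (volume.restrict U) := by
      have := ((LinearIsometry.toSpanSingleton ℝ 𝔼
        (v := EuclideanSpace.single i (1 : ℝ)) (by simp)).toContinuousLinearMap).comp_memLp'
        (hψ.memLp 2)
      refine this.ae_eq (Eventually.of_forall fun x => ?_)
      simp only [Function.comp_apply]
      ext j
      by_cases hj : j = i <;> simp [hj]
    have t2 := tendsto_integral_inner_of_tendsto_eLpNorm hP
      (fun n => (hφ n).memLp_gradient 2) hG h2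
    simp only [EuclideanSpace.inner_single_left, RCLike.inner_apply, conj_trivial] at t1 t2
    have t3 : Tendsto (fun n => ∫ x in U, φ n x * fderiv ℝ ψ x (EuclideanSpace.single i 1)) atTop
        (𝓝 (-∫ x in U, ψ x * G x i)) :=
      t2.neg.congr fun n => by
        rw [(hφ n).integral_mul_fderiv hψ i]
        simp_rw [mul_comm]
    rw [tendsto_nhds_unique t1 t3]
    simp_rw [mul_comm]
  have hae := weakGradient_ae_eq hU hwg
  refine ⟨⟨⟨hu, G, hwg, hG⟩, φ, hφ, h1, h2.congr fun n => eLpNorm_congr_ae ?_⟩, hae⟩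
  filter_upwards [hae] with x hx
  rw [hx]

theorem MemH10.memLp_weakGradient (hU : IsOpen U) {u : 𝔼 → ℝ} (h : MemH10 U u) :
    MemLp (weakGradient U u) 2 (volume.restrict U) := by
  obtain ⟨⟨-, g, hg, hg2⟩, -⟩ := h
  exact hg2.ae_eq (weakGradient_ae_eq hU hg).symm

/-- `H^{1,2}_0` functions are approximated by test functions in `H^{1,2}` and almost everywhere. -/
theorem MemH10.exists_seq {u : 𝔼 → ℝ} (h : MemH10 U u) :
    ∃ φ : ℕ → 𝔼 → ℝ, (∀ n, IsTestFunction U (φ n)) ∧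
      (∀ᵐ x ∂(volume.restrict U), Tendsto (fun n => φ n x) atTop (𝓝 (u x))) ∧
      Tendsto (fun n => eLpNorm (fun x => gradient (φ n) x - weakGradient U u x) 2
        (volume.restrict U)) atTop (𝓝 0) := by
  obtain ⟨⟨hu, -⟩, φ, hφ, h1, h2⟩ := h
  obtain ⟨ns, hns, hae⟩ := (tendstoInMeasure_of_tendsto_eLpNorm two_ne_zero
    (fun n => ((hφ n).memLp 2).1) hu.1 h1).exists_seq_tendsto_ae
  exact ⟨fun n => φ (ns n), fun n => hφ _, hae, h2.comp hns.tendsto_atTop⟩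

/-- Chain rule in the limit: composition with a smooth function with bounded derivative. -/
theorem tendsto_eLpNorm_gradient_comp {φ : ℕ → 𝔼 → ℝ} (hφ : ∀ n, IsTestFunction U (φ n))
    {u : 𝔼 → ℝ} {W : 𝔼 → 𝔼} (hW : MemLp W 2 (volume.restrict U))
    (h1 : ∀ᵐ x ∂(volume.restrict U), Tendsto (fun n => φ n x) atTop (𝓝 (u x)))
    (h2 : Tendsto (fun n => eLpNorm (fun x => gradient (φ n) x - W x) 2
      (volume.restrict U)) atTop (𝓝 0))
    {g : ℝ → ℝ} (hg : ContDiff ℝ ∞ g) {M : ℝ} (hM : ∀ s, |deriv g s| ≤ M) :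
    Tendsto (fun n => eLpNorm (fun x => gradient (fun y => g (φ n y)) x - deriv g (u x) • W x) 2
      (volume.restrict U)) atTop (𝓝 0) := by
  have hgc : Continuous (deriv g) := hg.continuous_deriv (by simp)
  have hm : ∀ n, AEStronglyMeasurable (fun x => deriv g (φ n x)) (volume.restrict U) := fun n =>
    (hgc.comp (hφ n).continuous).aestronglyMeasurable
  have t := tendsto_eLpNorm_sub_smul_of_bounded (b := fun n x => deriv g (φ n x))
    (b' := fun x => deriv g (u x)) hW hm (fun n x => hM _)
    (by filter_upwards [h1] with x hx using (hgc.tendsto _).comp hx)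
  have hm' : AEStronglyMeasurable (fun x => deriv g (u x)) (volume.restrict U) :=
    aestronglyMeasurable_of_tendsto_ae atTop hm
      (by filter_upwards [h1] with x hx using (hgc.tendsto _).comp hx)
  have t' : Tendsto (fun n => ENNReal.ofReal M *
      eLpNorm (fun x => gradient (φ n) x - W x) 2 (volume.restrict U) +
      eLpNorm (fun x => (deriv g (φ n x) - deriv g (u x)) • W x) 2 (volume.restrict U)) atTop
      (𝓝 0) := by
    simpa using (ENNReal.Tendsto.const_mul h2 (Or.inr ENNReal.ofReal_ne_top)).add t
  refine tendsto_of_tendsto_of_tendsto_of_le_of_le tendsto_const_nhds t'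
    (fun n => zero_le) fun n => ?_
  -- The first summand is at most M times the gradient error; the second tends to zero by dominated
  -- convergence.
  have e : (fun x => gradient (fun y => g (φ n y)) x - deriv g (u x) • W x) =
      (fun x => deriv g (φ n x) • (gradient (φ n) x - W x)) +
        fun x => (deriv g (φ n x) - deriv g (u x)) • W x := by
    ext1 x
    rw [(hφ n).gradient_comp hg, Pi.add_apply]
    module
  rw [e]
  refine (eLpNorm_add_le ((hm n).smul (((hφ n).memLp_gradient 2).1.sub hW.1))
    (((hm n).sub hm').smul hW.1) (by norm_num)).trans
    (add_le_add ?_ le_rfl)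
  refine eLpNorm_le_mul_eLpNorm_of_ae_le_mul (Eventually.of_forall fun x => ?_) _
  change ‖deriv g (φ n x) • (gradient (φ n) x - W x)‖ ≤ _
  rw [norm_smul]
  exact mul_le_mul_of_nonneg_right (hM _) (norm_nonneg _)

/-- The Sobolev inequality for limits of test functions. -/
theorem eLpNorm_le_of_tendsto_gradient (hd : 3 ≤ d) {φ : ℕ → 𝔼 → ℝ}
    (hφ : ∀ n, IsTestFunction U (φ n))
    {u : 𝔼 → ℝ} {W : 𝔼 → 𝔼} (hW : MemLp W 2 (volume.restrict U))
    (h1 : ∀ᵐ x ∂(volume.restrict U), Tendsto (fun n => φ n x) atTop (𝓝 (u x)))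
    (h2 : Tendsto (fun n => eLpNorm (fun x => gradient (φ n) x - W x) 2
      (volume.restrict U)) atTop (𝓝 0)) :
    eLpNorm u (ENNReal.ofReal (2 * d / (d - 2))) (volume.restrict U) ≤
      ENNReal.ofReal (2 * (d - 1) / (d - 2)) * eLpNorm W 2 (volume.restrict U) := by
  -- Fatou along the almost everywhere convergent sequence.
  refine (Lp.eLpNorm_lim_le_liminf_eLpNorm (fun n => ((hφ n).memLp 2).1) u h1).trans ?_
  have t : Tendsto (fun n => ENNReal.ofReal (2 * (d - 1) / (d - 2)) *
      (eLpNorm (fun x => gradient (φ n) x - W x) 2 (volume.restrict U) +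
        eLpNorm W 2 (volume.restrict U))) atTop
      (𝓝 (ENNReal.ofReal (2 * (d - 1) / (d - 2)) * (0 + eLpNorm W 2 (volume.restrict U)))) :=
    ENNReal.Tendsto.const_mul (h2.add_const _) (Or.inr ENNReal.ofReal_ne_top)
  rw [zero_add] at t
  rw [← t.liminf_eq]
  refine liminf_le_liminf (Eventually.of_forall fun n => ((hφ n).eLpNorm_le hd).trans ?_)
  gcongr
  have := eLpNorm_add_le (((hφ n).memLp_gradient 2).1.sub hW.1) hW.1 (p := 2) (by norm_num)
  rw [sub_add_cancel] at this
  exact this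

end TestFunctions

/-! ### Testing with functions of the solution; uniqueness -/

section Testing

variable {d : ℕ} {U : Set (EuclideanSpace ℝ (Fin d))}

local notation "𝔼" => EuclideanSpace ℝ (Fin d)

/-- Composition with a bounded smooth function with bounded derivative may be used as a test
function. -/
theorem MemH10.integral_comp_eq (hU : IsOpen U) {u c f : 𝔼 → ℝ} (hu : MemH10 U u)
    (hcu : IntegrableOn (fun x => c x * u x) U volume) (hf : IntegrableOn f U volume)
    (heq : ∀ φ : 𝔼 → ℝ, IsTestFunction U φ →
      (∫ x in U, inner ℝ (weakGradient U u x) (gradient φ x)) + ∫ x in U, c x * u x * φ x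
        = ∫ x in U, f x * φ x)
    {g : ℝ → ℝ} (hg : ContDiff ℝ ∞ g) (g0 : g 0 = 0) {B M : ℝ} (hB : ∀ s, |g s| ≤ B)
    (hM : ∀ s, |deriv g s| ≤ M) :
    (∫ x in U, deriv g (u x) * ‖weakGradient U u x‖ ^ 2) + ∫ x in U, c x * u x * g (u x)
      = ∫ x in U, f x * g (u x) := by
  obtain ⟨φ, hφ, h1, h2⟩ := hu.exists_seq
  have hW := hu.memLp_weakGradient hU
  have hψ : ∀ n, IsTestFunction U (fun x => g (φ n x)) := fun n => (hφ n).comp hg g0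
  have hgc : Continuous (deriv g) := hg.continuous_deriv (by simp)
  have hum : AEStronglyMeasurable u (volume.restrict U) := hu.1.1.1
  have hgW : MemLp (fun x => deriv g (u x) • weakGradient U u x) 2 (volume.restrict U) := by
    refine hW.of_le_mul (c := M) ((hgc.comp_aestronglyMeasurable hum).smul hW.1)
      (Eventually.of_forall fun x => ?_)
    rw [norm_smul]
    exact mul_le_mul_of_nonneg_right (hM _) (norm_nonneg _)
  have t1 := tendsto_integral_inner_of_tendsto_eLpNorm hW (fun n => (hψ n).memLp_gradient 2) hgW
    (tendsto_eLpNorm_gradient_comp hφ hW h1 h2 hg hM)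
  -- Here k is only in L¹, so domination relies on the bound B for g.
  have hdom : ∀ {k : 𝔼 → ℝ}, IntegrableOn k U volume →
      Tendsto (fun n => ∫ x in U, k x * g (φ n x)) atTop (𝓝 (∫ x in U, k x * g (u x))) := by
    intro k hk
    refine tendsto_integral_of_dominated_convergence (fun x => ‖k x‖ * B) ?_ ?_ ?_ ?_
    · exact fun n => hk.1.mul ((hψ n).memLp 2).1
    · exact hk.norm.mul_const B
    · intro n
      refine Eventually.of_forall fun x => ?_
      rw [norm_mul]
      exact mul_le_mul_of_nonneg_left (hB _) (norm_nonneg _)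
    · filter_upwards [h1] with x hx
      exact ((hg.continuous.tendsto _).comp hx).const_mul _
  have t2 := t1.add (hdom hcu)
  have := tendsto_nhds_unique (t2.congr fun n => heq _ (hψ n)) (hdom hf)
  rw [← this]
  congr 1
  refine integral_congr_ae (Eventually.of_forall fun x => ?_)
  simp only [real_inner_smul_right, real_inner_self_eq_norm_sq]

theorem MemH10.eLpNorm_le (hd : 3 ≤ d) (hU : IsOpen U) {u : 𝔼 → ℝ} (hu : MemH10 U u) :
    eLpNorm u (ENNReal.ofReal (2 * d / (d - 2))) (volume.restrict U) ≤
      ENNReal.ofReal (2 * (d - 1) / (d - 2)) *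
        eLpNorm (weakGradient U u) 2 (volume.restrict U) := by
  obtain ⟨φ, hφ, h1, h2⟩ := hu.exists_seq
  exact eLpNorm_le_of_tendsto_gradient hd hφ (hu.memLp_weakGradient hU) h1 h2

/-- The Sobolev inequality for the composition of an `H^{1,2}_0` function with a smooth function. -/
theorem MemH10.eLpNorm_comp_le (hd : 3 ≤ d) (hU : IsOpen U) {u : 𝔼 → ℝ} (hu : MemH10 U u)
    {g : ℝ → ℝ} (hg : ContDiff ℝ ∞ g) (g0 : g 0 = 0) {M : ℝ} (hM : ∀ s, |deriv g s| ≤ M) :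
    eLpNorm (fun x => g (u x)) (ENNReal.ofReal (2 * d / (d - 2))) (volume.restrict U) ≤
      ENNReal.ofReal (2 * (d - 1) / (d - 2)) *
        eLpNorm (fun x => deriv g (u x) • weakGradient U u x) 2 (volume.restrict U) := by
  obtain ⟨φ, hφ, h1, h2⟩ := hu.exists_seq
  have hW := hu.memLp_weakGradient hU
  have hgc : Continuous (deriv g) := hg.continuous_deriv (by simp)
  have hgW : MemLp (fun x => deriv g (u x) • weakGradient U u x) 2 (volume.restrict U) := by
    refine hW.of_le_mul (c := M) ((hgc.comp_aestronglyMeasurable hu.1.1.1).smul hW.1)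
      (Eventually.of_forall fun x => ?_)
    rw [norm_smul]
    exact mul_le_mul_of_nonneg_right (hM _) (norm_nonneg _)
  refine eLpNorm_le_of_tendsto_gradient hd (fun n => (hφ n).comp hg g0) hgW ?_
    (tendsto_eLpNorm_gradient_comp hφ hW h1 h2 hg hM)
  filter_upwards [h1] with x hx
  exact (hg.continuous.tendsto _).comp hx

theorem MemH10.memLp_sobolev (hd : 3 ≤ d) (hU : IsOpen U) {u : 𝔼 → ℝ} (hu : MemH10 U u) :
    MemLp u (ENNReal.ofReal (2 * d / (d - 2))) (volume.restrict U) :=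
  ⟨hu.1.1.1, (hu.eLpNorm_le hd hU).trans_lt
    (ENNReal.mul_lt_top ENNReal.ofReal_lt_top (hu.memLp_weakGradient hU).2)⟩

theorem holderConjugate_sobolev (hd : 3 ≤ d) :
    ENNReal.HolderConjugate (ENNReal.ofReal (2 * d / (d + 2)))
      (ENNReal.ofReal (2 * d / (d - 2))) := by
  have hd3 : (3 : ℝ) ≤ d := by exact_mod_cast hd
  have hd2 : (0 : ℝ) < d - 2 := by linarith
  refine Real.HolderConjugate.ennrealOfReal ?_
  rw [Real.holderConjugate_iff]
  refine ⟨?_, ?_⟩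
  · rw [one_lt_div (by positivity)]; linarith
  · field_simp; ring

/-- Hölder with the Sobolev exponent and its conjugate. This is why (i) needs no separate
integrability assumption on the product. -/
theorem MemH10.integrable_mul (hd : 3 ≤ d) (hU : IsOpen U) {u c : 𝔼 → ℝ} (hu : MemH10 U u)
    (hc : MemLp c (ENNReal.ofReal (2 * d / (d + 2))) (volume.restrict U)) :
    IntegrableOn (fun x => c x * u x) U volume :=
  haveI := holderConjugate_sobolev hd
  hc.integrable_mul (hu.memLp_sobolev hd hU)

/-- Uniqueness for the homogeneous equation. -/
theorem MemH10.ae_eq_zero (hd : 3 ≤ d) (hU : IsOpen U) {v c : 𝔼 → ℝ} (hv : MemH10 U v)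
    (hcv : IntegrableOn (fun x => c x * v x) U volume)
    (hc0 : ∀ᵐ x ∂(volume.restrict U), 0 ≤ c x)
    (heq : ∀ φ : 𝔼 → ℝ, IsTestFunction U φ →
      (∫ x in U, inner ℝ (weakGradient U v x) (gradient φ x)) + ∫ x in U, c x * v x * φ x = 0) :
    v =ᵐ[volume.restrict U] 0 := by
  -- The arctangent is bounded, has the sign of its argument and a strictly positive bounded
  -- derivative; so both terms of the tested identity are nonnegative and vanish, and the first then
  -- forces the gradient to vanish.
  have hM : ∀ s, |deriv Real.arctan s| ≤ 1 := fun s => by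
    rw [Real.deriv_arctan, abs_of_nonneg (by positivity), div_le_one (by positivity)]
    nlinarith [sq_nonneg s]
  have hB : ∀ s, |Real.arctan s| ≤ Real.pi / 2 := fun s =>
    abs_le.2 ⟨(Real.neg_pi_div_two_lt_arctan s).le, (Real.arctan_lt_pi_div_two s).le⟩
  have key := hv.integral_comp_eq hU hcv (f := 0) integrableOn_zero
    (fun φ hφ => by simpa using heq φ hφ) Real.contDiff_arctan Real.arctan_zero hB hM
  simp only [Pi.zero_apply, zero_mul, integral_zero] at key
  have n1 : 0 ≤ ∫ x in U, deriv Real.arctan (v x) * ‖weakGradient U v x‖ ^ 2 :=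
    integral_nonneg fun x => by
      simp only [Real.deriv_arctan, Pi.zero_apply]; positivity
  have n2 : 0 ≤ ∫ x in U, c x * v x * Real.arctan (v x) := by
    refine integral_nonneg_of_ae ?_
    filter_upwards [hc0] with x hx
    rw [mul_assoc]
    refine mul_nonneg hx ?_
    rcases le_total 0 (v x) with h | h
    · exact mul_nonneg h (Real.arctan_nonneg.2 h)
    · exact mul_nonneg_of_nonpos_of_nonpos h ((Real.arctan_strictMono.monotone h).trans_eq Real.arctan_zero)
  have z : ∫ x in U, deriv Real.arctan (v x) * ‖weakGradient U v x‖ ^ 2 = 0 := by linarith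
  have hW := hv.memLp_weakGradient hU
  have hint : Integrable (fun x => deriv Real.arctan (v x) * ‖weakGradient U v x‖ ^ 2)
      (volume.restrict U) := by
    refine hW.norm.integrable_sq.bdd_mul (c := 1)
      (((Real.contDiff_arctan (n := ∞)).continuous_deriv (by simp)).comp_aestronglyMeasurable
        hv.1.1.1) (Eventually.of_forall fun x => hM _)
  rw [integral_eq_zero_iff_of_nonneg (fun x => by
      simp only [Real.deriv_arctan, Pi.zero_apply]; positivity) hint] at z
  have hW0 : weakGradient U v =ᵐ[volume.restrict U] 0 := by
    filter_upwards [z] with x hx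
    simp only [Real.deriv_arctan, Pi.zero_apply, mul_eq_zero, pow_eq_zero_iff two_ne_zero,
      norm_eq_zero] at hx
    have : (1 / (1 + v x ^ 2)) ≠ 0 := by positivity
    exact (hx.resolve_left this)
  have hs := hv.eLpNorm_le hd hU
  rw [eLpNorm_congr_ae hW0, eLpNorm_zero, mul_zero, nonpos_iff_eq_zero] at hs
  have hd3 : (3 : ℝ) ≤ d := by exact_mod_cast hd
  have hd2 : (0 : ℝ) < d - 2 := by linarith
  exact (eLpNorm_eq_zero_iff hv.1.1.1 (by positivity)).1 hs

theorem MemH10.sub (hU : IsOpen U) {u w : 𝔼 → ℝ} (hu : MemH10 U u) (hw : MemH10 U w) :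
    MemH10 U (fun x => u x - w x) ∧ weakGradient U (fun x => u x - w x) =ᵐ[volume.restrict U]
      fun x => weakGradient U u x - weakGradient U w x := by
  have hWu := hu.memLp_weakGradient hU
  have hWw := hw.memLp_weakGradient hU
  obtain ⟨⟨hu2, -⟩, φ, hφ, h1, h2⟩ := hu
  obtain ⟨⟨hw2, -⟩, ψ, hψ, k1, k2⟩ := hw
  have hs : ∀ n, IsTestFunction U (φ n + (-1 : ℝ) • ψ n) := fun n => (hφ n).add ((hψ n).smul _)
  have hsub : ∀ {V : Type} [NormedAddCommGroup V] {a b : ℕ → 𝔼 → V} {e : ℕ → 𝔼 → V},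
      (∀ n, AEStronglyMeasurable (a n) (volume.restrict U)) →
      (∀ n, AEStronglyMeasurable (b n) (volume.restrict U)) →
      Tendsto (fun n => eLpNorm (a n) 2 (volume.restrict U)) atTop (𝓝 0) →
      Tendsto (fun n => eLpNorm (b n) 2 (volume.restrict U)) atTop (𝓝 0) →
      (∀ n, e n = a n - b n) →
      Tendsto (fun n => eLpNorm (e n) 2 (volume.restrict U)) atTop (𝓝 0) := by
    intro V _ a b e ha hb ta tb he
    have t := ta.add tb
    rw [add_zero] at t
    refine tendsto_of_tendsto_of_tendsto_of_le_of_le tendsto_const_nhds t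
      (fun n => zero_le) fun n => ?_
    simp only [he]
    exact eLpNorm_sub_le (ha n) (hb n) (by norm_num)
  refine memH10_of_tendsto hU hs (hu2.sub hw2) (hWu.sub hWw) ?_ ?_
  · refine hsub (fun n => ((hφ n).memLp 2).1.sub hu2.1) (fun n => ((hψ n).memLp 2).1.sub hw2.1)
      h1 k1 fun n => ?_
    ext x
    simp only [Pi.add_apply, Pi.smul_apply, Pi.sub_apply, smul_eq_mul]
    ring
  · refine hsub (fun n => ((hφ n).memLp_gradient 2).1.sub hWu.1)
      (fun n => ((hψ n).memLp_gradient 2).1.sub hWw.1) h2 k2 fun n => ?_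
    ext1 x
    have hgr : gradient (φ n + (-1 : ℝ) • ψ n) x = gradient (φ n) x - gradient (ψ n) x := by
      have d1 := (hφ n).1.differentiable (by simp) x
      have d2 := (hψ n).1.differentiable (by simp) x
      simp only [gradient]
      rw [fderiv_add d1 (d2.const_smul _), fderiv_const_smul d2]
      simp [sub_eq_add_neg]
    simp only [hgr, Pi.sub_apply]
    abel

/-- Weak solutions are unique. -/
theorem IsWeakSolution.ae_eq (hd : 3 ≤ d) (hU : IsOpen U) {u w c f : 𝔼 → ℝ}
    (hc0 : ∀ᵐ x ∂(volume.restrict U), 0 ≤ c x)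
    (hu : IsWeakSolution U c f u) (hw : IsWeakSolution U c f w) :
    u =ᵐ[volume.restrict U] w := by
  obtain ⟨hu, hcu, hf, hue⟩ := hu
  obtain ⟨hw, hcw, -, hwe⟩ := hw
  obtain ⟨hv, hg⟩ := hu.sub hU hw
  have hz := hv.ae_eq_zero (c := c) hd hU ?_ hc0 ?_
  · filter_upwards [hz] with x hx
    exact sub_eq_zero.1 hx
  · refine (Integrable.sub hcu hcw).congr (Eventually.of_forall fun x => ?_)
    simp only [Pi.sub_apply]
    ring
  · intro φ hφ
    obtain ⟨B, hB⟩ := hφ.exists_bound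
    have hφm := (hφ.memLp 2).1
    have e1 : ∫ x in U, inner ℝ (weakGradient U (fun x => u x - w x) x) (gradient φ x)
        = (∫ x in U, inner ℝ (weakGradient U u x) (gradient φ x)) -
          ∫ x in U, inner ℝ (weakGradient U w x) (gradient φ x) := by
      rw [← integral_sub (integrable_inner_of_memLp_two (hu.memLp_weakGradient hU) (hφ.memLp_gradient 2))
        (integrable_inner_of_memLp_two (hw.memLp_weakGradient hU) (hφ.memLp_gradient 2))]
      refine integral_congr_ae ?_
      filter_upwards [hg] with x hx
      rw [hx, inner_sub_left]
    have e2 : ∫ x in U, c x * (u x - w x) * φ x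
        = (∫ x in U, c x * u x * φ x) - ∫ x in U, c x * w x * φ x := by
      rw [← integral_sub (hcu.mul_bdd (c := B) hφm (Eventually.of_forall hB))
        (hcw.mul_bdd (c := B) hφm (Eventually.of_forall hB))]
      congr 1; ext x; ring
    rw [e1, e2]
    linarith [hue φ hφ, hwe φ hφ]

end Testing

/-! ### Existence by Riesz representation -/

section Existence

/-- Riesz representation of a functional `F` dominated by a linear map `A` into a Hilbert space, by
a limit of elements of the range of `A`. -/
theorem exists_tendsto_inner_eq {T H H' : Type*} [AddCommGroup T] [Module ℝ T]
    [NormedAddCommGroup H] [InnerProductSpace ℝ H] [CompleteSpace H]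
    [NormedAddCommGroup H'] [NormedSpace ℝ H'] [CompleteSpace H']
    (A : T →ₗ[ℝ] H) (F : T →ₗ[ℝ] ℝ) (P : T →ₗ[ℝ] H') {C K : ℝ} (hC : ∀ t, |F t| ≤ C * ‖A t‖)
    (hK : ∀ t, ‖P t‖ ≤ K * ‖A t‖) :
    ∃ (t : ℕ → T) (h : H) (u : H'), Tendsto (fun n => A (t n)) atTop (𝓝 h) ∧
      Tendsto (fun n => P (t n)) atTop (𝓝 u) ∧ ∀ s, inner ℝ h (A s) = F s := by
  -- The domination makes F factor through the range of A, as a bounded functional there.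
  have hker : LinearMap.ker A ≤ LinearMap.ker F := by
    intro t ht
    have h0 : A t = 0 := ht
    have := hC t
    rw [h0, norm_zero, mul_zero] at this
    exact abs_nonpos_iff.1 this
  let g : LinearMap.range A →ₗ[ℝ] ℝ :=
    ((LinearMap.ker A).liftQ F hker).comp A.quotKerEquivRange.symm.toLinearMap
  have hg : ∀ t, g ⟨A t, LinearMap.mem_range_self A t⟩ = F t := by
    intro t
    have : A.quotKerEquivRange.symm ⟨A t, LinearMap.mem_range_self A t⟩
        = (LinearMap.ker A).mkQ t := A.quotKerEquivRange_symm_apply_image t _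
    change (LinearMap.ker A).liftQ F hker (A.quotKerEquivRange.symm _) = F t
    rw [this]
    rfl
  have hgb : ∀ y, ‖g y‖ ≤ C * ‖y‖ := by
    rintro ⟨_, t, rfl⟩
    rw [hg t]
    exact hC t
  obtain ⟨l, hl, -⟩ := exists_extension_norm_eq (LinearMap.range A) (g.mkContinuous C hgb)
  let S := (LinearMap.range A).topologicalClosure
  have : CompleteSpace S := (LinearMap.range A).isClosed_topologicalClosure.completeSpace_coe
  let h0 := (InnerProductSpace.toDual ℝ H).symm l
  -- The Hahn–Banach extension may have a Riesz vector off the closure of the range. Projecting it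
  -- there leaves the pairing with the range unchanged and makes it a limit of images `A (t n)`.
  have hmem : ((S.orthogonalProjectionOnto h0 : S) : H) ∈ closure (Set.range A) := by
    have := (S.orthogonalProjectionOnto h0).2
    exact this
  obtain ⟨y, hy, hyl⟩ := mem_closure_iff_seq_limit.1 hmem
  choose t ht using hy
  have htl : Tendsto (fun n => A (t n)) atTop (𝓝 ((S.orthogonalProjectionOnto h0 : S) : H)) := by
    simpa only [ht] using hyl
  have hcau : CauchySeq (fun n => P (t n)) := by
    have h1 := htl.cauchySeq
    rw [cauchySeq_iff_tendsto_dist_atTop_0] at h1 ⊢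
    have h2 := h1.const_mul K
    rw [mul_zero] at h2
    refine squeeze_zero (fun _ => dist_nonneg) (fun n => ?_) h2
    rw [dist_eq_norm, dist_eq_norm, ← map_sub, ← map_sub]
    exact hK _
  obtain ⟨u, hu⟩ := cauchySeq_tendsto_of_complete hcau
  refine ⟨t, _, u, htl, hu, fun s => ?_⟩
  have hs : A s ∈ S := (LinearMap.range A).le_topologicalClosure (LinearMap.mem_range_self A s)
  have e1 : inner ℝ ((S.orthogonalProjectionOnto h0 : S) : H) (A s) = inner ℝ h0 (A s) :=
    S.inner_orthogonalProjectionOnto_eq_of_mem_right ⟨A s, hs⟩ h0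
  rw [e1, InnerProductSpace.toDual_symm_apply]
  exact (hl ⟨A s, LinearMap.mem_range_self A s⟩).trans (hg s)

variable {d : ℕ} {U : Set (EuclideanSpace ℝ (Fin d))}

local notation "𝔼" => EuclideanSpace ℝ (Fin d)

/-- The space `C₀^∞(U)`. -/
def testFunctions (U : Set 𝔼) : Submodule ℝ (𝔼 → ℝ) where
  carrier := {φ | IsTestFunction U φ}
  add_mem' := fun h h' => h.add h'
  zero_mem' := IsTestFunction.zero
  smul_mem' := fun a _ h => h.smul a

/-- Test functions are bounded, so c ∈ L¹ suffices for the second component of the energy embedding.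
-/
theorem memLp_sqrt_mul {c : 𝔼 → ℝ} (hc : IntegrableOn c U volume) {φ : 𝔼 → ℝ}
    (hφ : IsTestFunction U φ) : MemLp (fun x => √(c x) * φ x) 2 (volume.restrict U) := by
  obtain ⟨B, hB⟩ := hφ.exists_bound
  have hs : MemLp (fun x => √(c x)) 2 (volume.restrict U) := by
    have hm : AEStronglyMeasurable (fun x => √(c x)) (volume.restrict U) :=
      Real.continuous_sqrt.comp_aestronglyMeasurable hc.1
    rw [memLp_two_iff_integrable_sq hm]
    refine hc.norm.mono' (hm.pow 2) (Eventually.of_forall fun x => ?_)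
    rw [Real.norm_of_nonneg (by positivity)]
    rcases le_total 0 (c x) with h | h
    · rw [Real.sq_sqrt h]; exact le_abs_self _
    · rw [Real.sqrt_eq_zero_of_nonpos h]; simp
  refine hs.of_le_mul (c := B) (hs.1.mul (hφ.memLp 2).1) (Eventually.of_forall fun x => ?_)
  rw [norm_mul, mul_comm]
  exact mul_le_mul_of_nonneg_right (hB x) (norm_nonneg _)

/-- The embedding of `C₀^∞(U)` given by the energy form `∫ ⟨∇φ, ∇ψ⟩ + ∫ c φ ψ`. -/
noncomputable def energyEmbedding {c : 𝔼 → ℝ} (hc : IntegrableOn c U volume) :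
    testFunctions U →ₗ[ℝ]
      WithLp 2 (Lp 𝔼 2 (volume.restrict U) × Lp ℝ 2 (volume.restrict U)) where
  toFun φ := WithLp.toLp 2 ((φ.2.memLp_gradient 2).toLp _, (memLp_sqrt_mul hc φ.2).toLp _)
  map_add' φ ψ := by
    rw [← WithLp.toLp_add, Prod.mk_add_mk, ← MemLp.toLp_add, ← MemLp.toLp_add]
    congr 2
    · refine MemLp.toLp_congr _ _ (Eventually.of_forall fun x => ?_)
      simp [gradient, fderiv_add (φ.2.1.differentiable (by simp) x)
        (ψ.2.1.differentiable (by simp) x)]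
    · refine MemLp.toLp_congr _ _ (Eventually.of_forall fun x => ?_)
      simp [mul_add]
  map_smul' a φ := by
    rw [RingHom.id_apply, ← WithLp.toLp_smul, Prod.smul_mk, ← MemLp.toLp_const_smul,
      ← MemLp.toLp_const_smul]
    congr 2
    · refine MemLp.toLp_congr _ _ (Eventually.of_forall fun x => ?_)
      simp [gradient, fderiv_const_smul (φ.2.1.differentiable (by simp) x)]
    · refine MemLp.toLp_congr _ _ (Eventually.of_forall fun x => ?_)
      simp [mul_left_comm]

/-- The embedding of `C₀^∞(U)` in `L²(U)`. -/
noncomputable def testFunctionsToLp : testFunctions U →ₗ[ℝ] Lp ℝ 2 (volume.restrict U) where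
  toFun φ := (φ.2.memLp 2).toLp _
  map_add' φ ψ := (φ.2.memLp 2).toLp_add (ψ.2.memLp 2)
  map_smul' a φ := (φ.2.memLp 2).toLp_const_smul a

/-- The functional `φ ↦ ∫ f φ` on `C₀^∞(U)`. -/
noncomputable def testFunctionsIntegral {f : 𝔼 → ℝ} (hf : IntegrableOn f U volume) :
    testFunctions U →ₗ[ℝ] ℝ where
  toFun φ := ∫ x in U, f x * φ.1 x
  map_add' φ ψ := by
    obtain ⟨B, hB⟩ := φ.2.exists_bound
    obtain ⟨B', hB'⟩ := ψ.2.exists_bound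
    rw [← integral_add (hf.mul_bdd (c := B) (φ.2.memLp 2).1 (Eventually.of_forall hB))
      (hf.mul_bdd (c := B') (ψ.2.memLp 2).1 (Eventually.of_forall hB'))]
    simp [mul_add]
  map_smul' a φ := by
    rw [RingHom.id_apply, smul_eq_mul, ← integral_const_mul]
    simp [mul_left_comm]

/-- Hölder followed by Sobolev. Only the gradient appears on the right, so c does not enter the
final estimate. -/
theorem IsTestFunction.abs_integral_mul_le (hd : 3 ≤ d) {f φ : 𝔼 → ℝ}
    (hf : MemLp f (ENNReal.ofReal (2 * d / (d + 2))) (volume.restrict U))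
    (hφ : IsTestFunction U φ) :
    |∫ x in U, f x * φ x| ≤ 2 * (d - 1) / (d - 2) *
        (eLpNorm f (ENNReal.ofReal (2 * d / (d + 2))) (volume.restrict U)).toReal *
        (eLpNorm (gradient φ) 2 (volume.restrict U)).toReal := by
  have := holderConjugate_sobolev hd
  have hd3 : (3 : ℝ) ≤ d := by exact_mod_cast hd
  have hγ : (0 : ℝ) ≤ 2 * (d - 1) / (d - 2) := div_nonneg (by linarith) (by linarith)
  have h1 : ‖∫ x in U, f x * φ x‖ₑ ≤
      eLpNorm f (ENNReal.ofReal (2 * d / (d + 2))) (volume.restrict U) *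
      (ENNReal.ofReal (2 * (d - 1) / (d - 2)) * eLpNorm (gradient φ) 2 (volume.restrict U)) := by
    refine (enorm_integral_le_lintegral_enorm _).trans ?_
    rw [← eLpNorm_one_eq_lintegral_enorm]
    exact (eLpNorm_smul_le_mul_eLpNorm (r := 1) (hφ.memLp 2).1 hf.1).trans
      (mul_le_mul_right (hφ.eLpNorm_le hd) _)
  have h2 := ENNReal.toReal_mono (ENNReal.mul_ne_top hf.2.ne
    (ENNReal.mul_ne_top ENNReal.ofReal_ne_top (hφ.memLp_gradient 2).2.ne)) h1
  rw [ENNReal.toReal_mul, ENNReal.toReal_mul, ENNReal.toReal_ofReal hγ, toReal_enorm,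
    Real.norm_eq_abs] at h2
  linarith

/-- The Poincaré inequality for test functions. -/
theorem exists_eLpNorm_le_of_isBounded (hd : 3 ≤ d) (hb : Bornology.IsBounded U) :
    ∃ K : ℝ, 0 ≤ K ∧ ∀ φ : 𝔼 → ℝ, IsTestFunction U φ →
      (eLpNorm φ 2 (volume.restrict U)).toReal ≤
        K * (eLpNorm (gradient φ) 2 (volume.restrict U)).toReal := by
  have hd3 : (3 : ℝ) ≤ d := by exact_mod_cast hd
  have hd2 : (0 : ℝ) < d - 2 := by linarith
  have hs2 : (2 : ℝ≥0∞) ≤ ENNReal.ofReal (2 * d / (d - 2)) := by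
    rw [← ENNReal.ofReal_ofNat]
    refine ENNReal.ofReal_le_ofReal ?_
    rw [le_div_iff₀ hd2]; linarith
  set V := volume.restrict U Set.univ ^
    (1 / (2 : ℝ≥0∞).toReal - 1 / (ENNReal.ofReal (2 * d / (d - 2))).toReal) with hV
  have hfin : volume.restrict U Set.univ ≠ ⊤ := by
    rw [Measure.restrict_apply_univ]; exact hb.measure_lt_top.ne
  have hVt : V ≠ ⊤ := by
    refine ENNReal.rpow_ne_top_of_nonneg ?_ hfin
    rw [sub_nonneg]
    exact one_div_le_one_div_of_le (by simp) (ENNReal.toReal_mono ENNReal.ofReal_ne_top hs2)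
  refine ⟨(ENNReal.ofReal (2 * (d - 1) / (d - 2)) * V).toReal, ENNReal.toReal_nonneg,
    fun φ hφ => ?_⟩
  rw [← ENNReal.toReal_mul]
  refine ENNReal.toReal_mono (ENNReal.mul_ne_top (ENNReal.mul_ne_top ENNReal.ofReal_ne_top hVt)
    (hφ.memLp_gradient 2).2.ne) ?_
  refine (eLpNorm_le_eLpNorm_mul_rpow_measure_univ hs2 (hφ.memLp 2).1).trans ?_
  refine (mul_le_mul_left (hφ.eLpNorm_le hd) V).trans_eq ?_
  ring

theorem one_le_sobolev_exponent (hd : 3 ≤ d) : 1 ≤ ENNReal.ofReal (2 * d / (d + 2)) := by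
  have hd3 : (3 : ℝ) ≤ d := by exact_mod_cast hd
  rw [ENNReal.one_le_ofReal, one_le_div (by positivity)]
  linarith

theorem exists_isWeakSolution (hd : 3 ≤ d) (hU : IsOpen U) (hb : Bornology.IsBounded U)
    {c f : 𝔼 → ℝ} (hc : MemLp c (ENNReal.ofReal (2 * d / (d + 2))) (volume.restrict U))
    (hc0 : ∀ᵐ x ∂(volume.restrict U), 0 ≤ c x)
    (hf : MemLp f (ENNReal.ofReal (2 * d / (d + 2))) (volume.restrict U)) :
    ∃ u : 𝔼 → ℝ, IsWeakSolution U c f u ∧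
      eLpNorm (weakGradient U u) 2 (volume.restrict U) ≤
        ENNReal.ofReal (2 * (d - 1) / (d - 2)) *
          eLpNorm f (ENNReal.ofReal (2 * d / (d + 2))) (volume.restrict U) := by
  have hd3 : (3 : ℝ) ≤ d := by exact_mod_cast hd
  have hγ : (0 : ℝ) ≤ 2 * (d - 1) / (d - 2) := div_nonneg (by linarith) (by linarith)
  have : IsFiniteMeasure (volume.restrict U) := ⟨by
    rw [Measure.restrict_apply_univ]; exact hb.measure_lt_top⟩
  have hc1 : IntegrableOn c U volume := hc.integrable (one_le_sobolev_exponent hd)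
  have hf1 : IntegrableOn f U volume := hf.integrable (one_le_sobolev_exponent hd)
  obtain ⟨K, hK0, hK⟩ := exists_eLpNorm_le_of_isBounded hd hb
  set C : ℝ := 2 * (d - 1) / (d - 2) *
    (eLpNorm f (ENNReal.ofReal (2 * d / (d + 2))) (volume.restrict U)).toReal with hC
  have hC0 : 0 ≤ C := mul_nonneg hγ ENNReal.toReal_nonneg
  let A := energyEmbedding hc1
  have hAfst : ∀ φ : testFunctions U,
      ‖(A φ).fst‖ = (eLpNorm (gradient φ.1) 2 (volume.restrict U)).toReal := fun φ =>
    Lp.norm_toLp _ (φ.2.memLp_gradient 2)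
  have hfst : ∀ z : WithLp 2 (Lp 𝔼 2 (volume.restrict U) × Lp ℝ 2 (volume.restrict U)),
      ‖z.fst‖ ≤ ‖z‖ := fun z => by
    rw [WithLp.prod_norm_eq_of_L2]
    exact Real.le_sqrt_of_sq_le (by nlinarith [sq_nonneg ‖z.snd‖])
  have hF : ∀ φ : testFunctions U, |testFunctionsIntegral hf1 φ| ≤ C * ‖(A φ).fst‖ := fun φ => by
    rw [hAfst]
    exact φ.2.abs_integral_mul_le hd hf
  obtain ⟨t, h, w, htA, htw, hin⟩ := exists_tendsto_inner_eq A (testFunctionsIntegral hf1)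
    testFunctionsToLp (C := C) (K := K)
    (fun φ => (hF φ).trans (mul_le_mul_of_nonneg_left (hfst _) hC0))
    (fun φ => by
      refine le_trans ?_ (mul_le_mul_of_nonneg_left (hfst _) hK0)
      rw [hAfst]
      exact (Lp.norm_toLp _ (φ.2.memLp 2)).trans_le (hK _ φ.2))
  have hG : MemLp h.fst 2 (volume.restrict U) := Lp.memLp _
  have ht1 : Tendsto (fun n => (A (t n)).fst) atTop (𝓝 h.fst) :=
    (WithLp.prod_continuous_ofLp 2 _ _).fst.tendsto h |>.comp htA
  have ht2 : Tendsto (fun n => (A (t n)).snd) atTop (𝓝 h.snd) :=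
    (WithLp.prod_continuous_ofLp 2 _ _).snd.tendsto h |>.comp htA
  have s1 : Tendsto (fun n => eLpNorm (fun x => gradient (t n).1 x - h.fst x) 2
      (volume.restrict U)) atTop (𝓝 0) := by
    refine ((Lp.tendsto_Lp_iff_tendsto_eLpNorm' _ _).1 ht1).congr fun n => eLpNorm_congr_ae ?_
    filter_upwards [((t n).2.memLp_gradient 2).coeFn_toLp] with x hx
    rw [← hx]; rfl
  have s2 : Tendsto (fun n => eLpNorm (fun x => √(c x) * (t n).1 x - h.snd x) 2
      (volume.restrict U)) atTop (𝓝 0) := by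
    refine ((Lp.tendsto_Lp_iff_tendsto_eLpNorm' _ _).1 ht2).congr fun n => eLpNorm_congr_ae ?_
    filter_upwards [(memLp_sqrt_mul hc1 (t n).2).coeFn_toLp] with x hx
    rw [← hx]; rfl
  have s3 : Tendsto (fun n => eLpNorm (fun x => (t n).1 x - w x) 2
      (volume.restrict U)) atTop (𝓝 0) := by
    refine ((Lp.tendsto_Lp_iff_tendsto_eLpNorm' _ _).1 htw).congr fun n => eLpNorm_congr_ae ?_
    filter_upwards [((t n).2.memLp 2).coeFn_toLp] with x hx
    rw [← hx]; rfl
  obtain ⟨hw, hgw⟩ := memH10_of_tendsto hU (fun n => (t n).2) (Lp.memLp w) hG s3 s1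
  -- The two L² limits are matched along a common subsequence converging almost everywhere.
  have hsnd : (fun x => √(c x) * w x) =ᵐ[volume.restrict U] h.snd := by
    obtain ⟨ns, hns, hae⟩ := (tendstoInMeasure_of_tendsto_eLpNorm two_ne_zero
      (fun n => ((t n).2.memLp 2).1) (Lp.memLp w).1 s3).exists_seq_tendsto_ae
    obtain ⟨ms, hms, hae'⟩ := (tendstoInMeasure_of_tendsto_eLpNorm two_ne_zero
      (fun n => (memLp_sqrt_mul hc1 (t (ns n)).2).1) (Lp.memLp h.snd).1
      (s2.comp hns.tendsto_atTop)).exists_seq_tendsto_ae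
    filter_upwards [hae, hae'] with x hx hx'
    exact tendsto_nhds_unique ((hx.comp hms.tendsto_atTop).const_mul _) hx'
  refine ⟨w, ⟨hw, hw.integrable_mul hd hU hc, hf1, fun φ hφ => ?_⟩, ?_⟩
  · have e := hin ⟨φ, hφ⟩
    rw [WithLp.prod_inner_apply, L2.inner_def, L2.inner_def] at e
    refine Eq.trans ?_ e
    congr 1
    · refine integral_congr_ae ?_
      filter_upwards [hgw, (hφ.memLp_gradient 2).coeFn_toLp] with x h1 h2
      rw [h1, ← h2]
      rfl
    · refine integral_congr_ae ?_
      filter_upwards [hsnd, (memLp_sqrt_mul hc1 hφ).coeFn_toLp, hc0] with x h1 h2 h3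
      have h4 : (A ⟨φ, hφ⟩).ofLp.2 x = √(c x) * φ x := h2
      have h5 : h.ofLp.2 x = √(c x) * w x := h1.symm
      rw [h4, h5]
      simp only [RCLike.inner_apply, conj_trivial]
      nth_rewrite 1 [← Real.mul_self_sqrt h3]
      ring
  -- Test the representation with the approximants themselves and pass to the limit. Since ‖h.fst‖ ≤
  -- ‖h‖, one factor cancels and ‖h.fst‖ ≤ C.
  · have hle : ‖h‖ ^ 2 ≤ C * ‖h.fst‖ := by
      have l1 : Tendsto (fun n => testFunctionsIntegral hf1 (t n)) atTop (𝓝 (‖h‖ ^ 2)) := by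
        rw [← real_inner_self_eq_norm_sq]
        exact ((tendsto_const_nhds (x := h)).inner htA).congr fun n => hin _
      exact le_of_tendsto_of_tendsto' l1 (ht1.norm.const_mul C)
        fun n => (le_abs_self _).trans (hF _)
    have hn : ‖h.fst‖ ≤ C := by
      by_contra! hlt
      nlinarith [hfst h, norm_nonneg h.fst]
    rw [eLpNorm_congr_ae hgw]
    rw [Lp.norm_def] at hn
    rw [← ENNReal.ofReal_toReal hG.2.ne, ← ENNReal.ofReal_toReal hf.2.ne, ← ENNReal.ofReal_mul hγ]
    exact ENNReal.ofReal_le_ofReal hn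

end Existence

/-! ### Smooth truncations and Stampacchia's lemma -/

section Truncation

/-- The derivative is continuous and vanishes outside the compact interval [0, 1]. -/
theorem Real.exists_bound_deriv_smoothTransition :
    ∃ M : ℝ, 0 < M ∧ ∀ s, deriv Real.smoothTransition s ≤ M := by
  have hc : Continuous (deriv Real.smoothTransition) :=
    (Real.smoothTransition.contDiff (n := 1)).continuous_deriv le_rfl
  obtain ⟨B, hB⟩ := isCompact_Icc.exists_bound_of_continuousOn (s := Set.Icc (0 : ℝ) 1)
    hc.continuousOn
  refine ⟨max B 1, by positivity, fun s => ?_⟩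
  by_cases hs : s ∈ Set.Icc (0 : ℝ) 1
  · exact (le_abs_self _).trans ((hB s hs).trans (le_max_left _ _))
  · have hz : deriv Real.smoothTransition s = 0 := by
      rw [Set.mem_Icc, not_and_or, not_le, not_le] at hs
      rcases hs with hs | hs
      · have : Real.smoothTransition =ᶠ[𝓝 s] fun _ => 0 := by
          filter_upwards [Iio_mem_nhds hs] with t ht
          exact Real.smoothTransition.zero_of_nonpos (le_of_lt ht)
        rw [this.deriv_eq, deriv_const]
      · have : Real.smoothTransition =ᶠ[𝓝 s] fun _ => 1 := by
          filter_upwards [Ioi_mem_nhds hs] with t ht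
          exact Real.smoothTransition.one_of_one_le (le_of_lt ht)
        rw [this.deriv_eq, deriv_const]
    rw [hz]
    positivity

/-- Smooth odd functions vanishing on `[-k, k]` and of absolute value `1` outside
`(-k - δ, k + δ)`. -/
theorem exists_smooth_truncation : ∃ M : ℝ, 0 < M ∧ ∀ k δ : ℝ, 0 ≤ k → 0 < δ →
    ∃ g : ℝ → ℝ, ContDiff ℝ ∞ g ∧ g 0 = 0 ∧ (∀ s, |g s| ≤ 1) ∧ (∀ s, |s| ≤ k → g s = 0) ∧
      (∀ s, k + δ ≤ |s| → |g s| = 1) ∧ (∀ s, 0 ≤ s * g s) ∧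
      (∀ s, 0 ≤ deriv g s) ∧ ∀ s, deriv g s ≤ M / δ := by
  obtain ⟨M, hM0, hM⟩ := Real.exists_bound_deriv_smoothTransition
  have hcd : ContDiff ℝ ∞ Real.smoothTransition := Real.smoothTransition.contDiff
  refine ⟨2 * M, by positivity, fun k δ hk hδ => ?_⟩
  let G := Real.smoothTransition
  have hneg : ∀ {t : ℝ}, t ≤ 0 → G (t / δ) = 0 := fun ht =>
    Real.smoothTransition.zero_of_nonpos (div_nonpos_of_nonpos_of_nonneg ht hδ.le)
  have hone : ∀ {t : ℝ}, δ ≤ t → G (t / δ) = 1 := fun ht =>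
    Real.smoothTransition.one_of_one_le ((one_le_div hδ).2 ht)
  have h0 : ∀ t, 0 ≤ G t := Real.smoothTransition.nonneg
  have h1 : ∀ t, G t ≤ 1 := Real.smoothTransition.le_one
  have hG0 : ∀ t, 0 ≤ deriv G t := fun t => Real.smoothTransition.monotone.deriv_nonneg
  have hder : ∀ s, HasDerivAt (fun s => G ((s - k) / δ) - G ((-s - k) / δ))
      ((deriv G ((s - k) / δ) + deriv G ((-s - k) / δ)) / δ) s := by
    intro s
    have hG : ∀ t, HasDerivAt G (deriv G t) t := fun t =>
      (hcd.differentiable (by simp) t).hasDerivAt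
    have i1 : HasDerivAt (fun s : ℝ => (s - k) / δ) (1 / δ) s :=
      ((hasDerivAt_id s).sub_const k).div_const δ
    have i2 : HasDerivAt (fun s : ℝ => (-s - k) / δ) (-1 / δ) s :=
      ((hasDerivAt_id s).neg.sub_const k).div_const δ
    refine (((hG _).comp s i1).sub ((hG _).comp s i2)).congr_deriv ?_
    ring
  -- One smooth step across [k, k + δ], reflected oddly; rescaling by δ costs the factor 1/δ in the
  -- derivative.
  refine ⟨fun s => G ((s - k) / δ) - G ((-s - k) / δ), ?_, ?_, ?_, ?_, ?_, ?_, ?_, ?_⟩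
  · exact (hcd.comp (by fun_prop)).sub (hcd.comp (by fun_prop))
  · simp only [neg_zero, zero_sub, sub_self]
  · exact fun s => abs_le.2 ⟨by linarith [h0 ((s - k) / δ), h1 ((-s - k) / δ)],
      by linarith [h1 ((s - k) / δ), h0 ((-s - k) / δ)]⟩
  · intro s hs
    beta_reduce
    rw [abs_le] at hs
    rw [hneg (by linarith), hneg (by linarith), sub_self]
  · intro s hs
    beta_reduce
    rcases le_abs.1 hs with hs | hs
    · rw [hone (by linarith), hneg (by linarith)]; simp
    · rw [hneg (by linarith), hone (by linarith)]; simp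
  · intro s
    beta_reduce
    rcases le_total 0 s with hs | hs
    · refine mul_nonneg hs ?_
      rw [hneg (t := -s - k) (by linarith), sub_zero]
      exact h0 _
    · refine mul_nonneg_of_nonpos_of_nonpos hs ?_
      rw [hneg (t := s - k) (by linarith), zero_sub]
      exact neg_nonpos.2 (h0 _)
  · intro s
    rw [(hder s).deriv]
    exact div_nonneg (add_nonneg (hG0 _) (hG0 _)) hδ.le
  · intro s
    rw [(hder s).deriv]
    gcongr
    linarith [hM ((s - k) / δ), hM ((-s - k) / δ)]

/-- **Stampacchia's lemma**. -/
theorem eq_zero_of_stampacchia {a : ℝ → ℝ} {σ β K D V : ℝ} (ha0 : ∀ k, 0 ≤ a k)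
    (ha : Antitone a) (hσ : 0 < σ) (hβ : 1 < β) (hK : 0 ≤ K) (hV : a 0 ≤ V) (hD : 0 < D)
    (hDK : K * (2 ^ (1 + 1 / (β - 1)) * V ^ ((β - 1) / σ)) ≤ D)
    (h : ∀ k δ, 0 ≤ k → 0 < δ → a (k + δ) ≤ (K / δ) ^ σ * a k ^ β) : a D = 0 := by
  have hb : 0 < β - 1 := by linarith
  have hV0 : 0 ≤ V := (ha0 0).trans hV
  -- The decay rate for which a(D(1 - 2⁻ⁿ)) ≤ V 2^(-νn) reproduces itself under the recursion,
  -- because σ - νβ = -ν. The lower bound on D is what starts this: (σ + ν)/σ = 1 + 1/(β-1).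
  set ν := σ / (β - 1) with hν
  have hν0 : 0 < ν := by positivity
  have e1 : σ - ν * β = -ν := by rw [hν]; field_simp; ring
  have hsmall : (K / D) ^ σ * V ^ (β - 1) ≤ 2 ^ (-(σ + ν)) := by
    have h2 : K / D * V ^ ((β - 1) / σ) ≤ 2 ^ (-(1 + 1 / (β - 1))) := by
      rw [Real.rpow_neg (by norm_num), div_mul_eq_mul_div, div_le_iff₀ hD, inv_mul_eq_div,
        le_div_iff₀ (by positivity)]
      linarith
    have h3 := Real.rpow_le_rpow (by positivity) h2 hσ.le
    rw [Real.mul_rpow (by positivity) (by positivity), ← Real.rpow_mul hV0,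
      ← Real.rpow_mul (by norm_num), div_mul_cancel₀ _ hσ.ne'] at h3
    convert h3 using 2
    rw [hν]; ring
  have key : ∀ n : ℕ, a (D * (1 - 2 ^ (-(n : ℝ)))) ≤ V * 2 ^ (-(ν * n)) := by
    intro n
    induction n with
    | zero => simpa using hV
    | succ n ih =>
      have hp : (2 : ℝ) ^ (-(n : ℝ)) ≤ 1 := Real.rpow_le_one_of_one_le_of_nonpos (by norm_num)
        (by simp)
      have hstep := h (D * (1 - 2 ^ (-(n : ℝ)))) (D * 2 ^ (-((n : ℝ) + 1)))
        (mul_nonneg hD.le (by linarith)) (by positivity)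
      have e2 : D * (1 - 2 ^ (-(n : ℝ))) + D * 2 ^ (-((n : ℝ) + 1))
          = D * (1 - 2 ^ (-((n + 1 : ℕ) : ℝ))) := by
        have : (2 : ℝ) ^ (-(n : ℝ)) = 2 * 2 ^ (-((n : ℝ) + 1)) := by
          rw [show -(n : ℝ) = 1 + -((n : ℝ) + 1) by ring, Real.rpow_add (by norm_num),
            Real.rpow_one]
        push_cast
        rw [this]; ring
      rw [e2] at hstep
      refine hstep.trans ?_
      calc (K / (D * 2 ^ (-((n : ℝ) + 1)))) ^ σ * a (D * (1 - 2 ^ (-(n : ℝ)))) ^ β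
          ≤ (K / (D * 2 ^ (-((n : ℝ) + 1)))) ^ σ * (V * 2 ^ (-(ν * n))) ^ β := by
            gcongr
            exact ha0 _
        _ = ((K / D) ^ σ * V ^ (β - 1)) * V * 2 ^ (((n : ℝ) + 1) * σ - ν * n * β) := by
            have i1 : K / (D * 2 ^ (-((n : ℝ) + 1))) = K / D * 2 ^ ((n : ℝ) + 1) := by
              rw [Real.rpow_neg (by norm_num)]; field_simp
            have i2 : V ^ β = V ^ (β - 1) * V := by
              rw [← Real.rpow_add_one' hV0 (by linarith)]; ring_nf
            have i3 : (2 : ℝ) ^ (((n : ℝ) + 1) * σ - ν * n * β)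
                = 2 ^ (((n : ℝ) + 1) * σ) * 2 ^ (-(ν * n) * β) := by
              rw [← Real.rpow_add (by norm_num)]; ring_nf
            rw [i1, Real.mul_rpow (by positivity) (by positivity),
              Real.mul_rpow hV0 (by positivity), i2, ← Real.rpow_mul (by norm_num),
              ← Real.rpow_mul (by norm_num), i3]
            ring
        _ ≤ 2 ^ (-(σ + ν)) * V * 2 ^ (((n : ℝ) + 1) * σ - ν * n * β) := by gcongr
        _ = V * 2 ^ (-(ν * ((n + 1 : ℕ) : ℝ))) := by
            rw [mul_right_comm, ← Real.rpow_add (by norm_num), mul_comm]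
            congr 2
            push_cast
            linear_combination (n : ℝ) * e1
  have hlim : Tendsto (fun n : ℕ => V * (2 : ℝ) ^ (-(ν * n))) atTop (𝓝 0) := by
    have : ∀ n : ℕ, (2 : ℝ) ^ (-(ν * n)) = ((2 : ℝ) ^ (-ν)) ^ n := fun n => by
      rw [← Real.rpow_mul_natCast (by norm_num)]; ring_nf
    simp only [this]
    have := tendsto_pow_atTop_nhds_zero_of_lt_one (r := (2 : ℝ) ^ (-ν)) (by positivity)
      (Real.rpow_lt_one_of_one_lt_of_neg (by norm_num) (by linarith))
    simpa using this.const_mul V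
  refine le_antisymm (ge_of_tendsto' hlim fun n => (ha ?_).trans (key n)) (ha0 D)
  have : (0 : ℝ) < 2 ^ (-(n : ℝ)) := by positivity
  nlinarith

end Truncation

/-! ### The L^∞ bound -/

section Bounded

variable {d : ℕ} {U : Set (EuclideanSpace ℝ (Fin d))}

local notation "𝔼" => EuclideanSpace ℝ (Fin d)

/-- Hölder on S, where g is at most one in absolute value. Applied with S = {|u| > k}, it supplies
the power of a(k) in the decay estimate. -/
theorem integral_mul_le_of_abs_le_one {α : Type*} [MeasurableSpace α] {μ : Measure α}
    [IsFiniteMeasure μ] {f g : α → ℝ} {r : ℝ} (hr : 1 ≤ r) (hf : MemLp f (ENNReal.ofReal r) μ)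
    {S : Set α} (hS : NullMeasurableSet S μ) (hg : ∀ x, |g x| ≤ 1) (hgS : ∀ x, x ∉ S → g x = 0) :
    |∫ x, f x * g x ∂μ| ≤ (eLpNorm f (ENNReal.ofReal r) μ).toReal * μ.real S ^ (1 - 1 / r) := by
  have h1 : ‖∫ x, f x * g x ∂μ‖ₑ ≤ eLpNorm f (ENNReal.ofReal r) μ * μ S ^ (1 - 1 / r) := by
    calc ‖∫ x, f x * g x ∂μ‖ₑ ≤ ∫⁻ x, ‖f x * g x‖ₑ ∂μ := enorm_integral_le_lintegral_enorm _
      _ ≤ ∫⁻ x, S.indicator (fun x => ‖f x‖ₑ) x ∂μ := by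
          refine lintegral_mono fun x => ?_
          by_cases hx : x ∈ S
          · rw [Set.indicator_of_mem hx, enorm_mul]
            refine mul_le_of_le_one_right' ?_
            rw [Real.enorm_eq_ofReal_abs]
            exact ENNReal.ofReal_le_one.2 (hg x)
          · simp [hgS x hx]
      _ = eLpNorm f 1 (μ.restrict S) := by
          rw [lintegral_indicator₀ hS, eLpNorm_one_eq_lintegral_enorm]
      _ ≤ eLpNorm f (ENNReal.ofReal r) (μ.restrict S) * μ S ^ (1 - 1 / r) := by
          have := eLpNorm_le_eLpNorm_mul_rpow_measure_univ (μ := μ.restrict S) (p := 1)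
            (q := ENNReal.ofReal r) (by rwa [ENNReal.one_le_ofReal]) hf.1.restrict
          simpa [ENNReal.toReal_ofReal (zero_le_one.trans hr)] using this
      _ ≤ _ := by
          exact mul_le_mul_left (eLpNorm_mono_measure f Measure.restrict_le_self) _
  have he : 0 ≤ 1 - 1 / r := by
    rw [sub_nonneg, div_le_one (by linarith)]; exact hr
  have h2 := ENNReal.toReal_mono (ENNReal.mul_ne_top hf.2.ne
    (ENNReal.rpow_ne_top_of_nonneg he (measure_ne_top _ _))) h1
  rwa [ENNReal.toReal_mul, ← ENNReal.toReal_rpow, toReal_enorm, Real.norm_eq_abs] at h2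

/-- The decay of the measure of the superlevel sets of a weak solution. -/
theorem IsWeakSolution.measure_superlevel_le (hd : 3 ≤ d) (hU : IsOpen U)
    (hb : Bornology.IsBounded U) {u c f : 𝔼 → ℝ}
    (hc0 : ∀ᵐ x ∂(volume.restrict U), 0 ≤ c x) (hu : IsWeakSolution U c f u) {r : ℝ} (hr : 1 ≤ r)
    (hf : MemLp f (ENNReal.ofReal r) (volume.restrict U)) {M k δ : ℝ} (hM0 : 0 < M)
    (hδ : 0 < δ) {g : ℝ → ℝ} (hg : ContDiff ℝ ∞ g) (g0 : g 0 = 0) (hg1 : ∀ s, |g s| ≤ 1)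
    (hgk : ∀ s, |s| ≤ k → g s = 0) (hgδ : ∀ s, k + δ ≤ |s| → |g s| = 1)
    (hgs : ∀ s, 0 ≤ s * g s) (hg' : ∀ s, 0 ≤ deriv g s) (hgM : ∀ s, deriv g s ≤ M / δ) :
    (volume.restrict U).real {x | k + δ < |u x|} ≤
      ((2 * (d - 1) / (d - 2)) ^ 2 * M *
        (eLpNorm f (ENNReal.ofReal r) (volume.restrict U)).toReal / δ) ^ ((d : ℝ) / (d - 2)) *
      (volume.restrict U).real {x | k < |u x|} ^ ((d : ℝ) / (d - 2) * (1 - 1 / r)) := by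
  have : IsFiniteMeasure (volume.restrict U) := ⟨by
    rw [Measure.restrict_apply_univ]; exact hb.measure_lt_top⟩
  have hd3 : (3 : ℝ) ≤ d := by exact_mod_cast hd
  have hd2 : (0 : ℝ) < d - 2 := by linarith
  have hd1 : (0 : ℝ) < d - 1 := by linarith
  set γ : ℝ := 2 * (d - 1) / (d - 2) with hγ
  have hγ0 : 0 ≤ γ := by positivity
  set s : ℝ := 2 * d / (d - 2) with hs
  have hs0 : 0 < s := by positivity
  have hs2 : (d : ℝ) / (d - 2) = s / 2 := by rw [hs]; ring
  set N := (eLpNorm f (ENNReal.ofReal r) (volume.restrict U)).toReal with hN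
  obtain ⟨hu, hcu, hf1, hue⟩ := hu
  have hgM' : ∀ s, |deriv g s| ≤ M / δ := fun s => by rw [abs_of_nonneg (hg' s)]; exact hgM s
  have hgc : Continuous (deriv g) := hg.continuous_deriv (by simp)
  have hum := hu.1.1.1
  have hW := hu.memLp_weakGradient hU
  have key := hu.integral_comp_eq hU hcu hf1 hue hg g0 hg1 hgM'
  have hS : NullMeasurableSet {x | k < |u x|} (volume.restrict U) :=
    nullMeasurableSet_lt aemeasurable_const hum.norm.aemeasurable
  have hfS := integral_mul_le_of_abs_le_one hr hf (g := fun x => g (u x)) hS (fun x => hg1 _)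
    (fun x hx => hgk _ (not_lt.1 hx))
  have n2 : 0 ≤ ∫ x in U, c x * u x * g (u x) := by
    refine integral_nonneg_of_ae ?_
    filter_upwards [hc0] with x hx
    rw [mul_assoc]
    exact mul_nonneg hx (hgs _)
  set a := (volume.restrict U).real {x | k < |u x|} with ha
  have hE : ∫ x in U, deriv g (u x) * ‖weakGradient U u x‖ ^ 2 ≤ N * a ^ (1 - 1 / r) := by
    have := (le_abs_self _).trans hfS
    linarith
  have hint : Integrable (fun x => deriv g (u x) * ‖weakGradient U u x‖ ^ 2)
      (volume.restrict U) :=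
    hW.norm.integrable_sq.bdd_mul (c := M / δ) (hgc.comp_aestronglyMeasurable hum)
      (Eventually.of_forall fun x => hgM' _)
  have hgW : MemLp (fun x => deriv g (u x) • weakGradient U u x) 2 (volume.restrict U) := by
    refine hW.of_le_mul (c := M / δ) ((hgc.comp_aestronglyMeasurable hum).smul hW.1)
      (Eventually.of_forall fun x => ?_)
    rw [norm_smul]
    exact mul_le_mul_of_nonneg_right (hgM' _) (norm_nonneg _)
  -- The energy identity controls ∫ g'(u)|∇u|², while Sobolev for g(u) needs g'(u)²; one factor is
  -- bounded by M/δ.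
  have hsq : (eLpNorm (fun x => deriv g (u x) • weakGradient U u x) 2
      (volume.restrict U)).toReal ^ 2 ≤ M / δ * (N * a ^ (1 - 1 / r)) := by
    have e1 : (eLpNorm (fun x => deriv g (u x) • weakGradient U u x) 2
        (volume.restrict U)).toReal ^ 2
        = ∫ x in U, ‖deriv g (u x) • weakGradient U u x‖ ^ 2 := by
      rw [← Lp.norm_toLp _ hgW, ← real_inner_self_eq_norm_sq, L2.inner_def]
      refine integral_congr_ae ?_
      filter_upwards [hgW.coeFn_toLp] with x hx
      rw [hx, real_inner_self_eq_norm_sq]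
    rw [e1]
    refine le_trans ?_ (mul_le_mul_of_nonneg_left hE (by positivity))
    rw [← integral_const_mul]
    refine integral_mono hgW.norm.integrable_sq (hint.const_mul _) fun x => ?_
    simp only [norm_smul, mul_pow, Real.norm_eq_abs, sq_abs]
    rw [← mul_assoc, sq (deriv g (u x))]
    gcongr
    · exact hg' _
    · exact hgM _
  have hsob := hu.eLpNorm_comp_le hd hU hg g0 hgM'
  -- Chebyshev at height 1, as |g(u)| = 1 where |u| > k + δ.
  have hcheb := mul_meas_ge_le_pow_eLpNorm' (volume.restrict U) (p := ENNReal.ofReal s)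
    (by positivity) ENNReal.ofReal_ne_top (hg.continuous.comp_aestronglyMeasurable hum) 1
  rw [ENNReal.one_rpow, one_mul, ENNReal.toReal_ofReal hs0.le] at hcheb
  have hmeas : (volume.restrict U) {x | k + δ < |u x|} ≤
      (ENNReal.ofReal γ * eLpNorm (fun x => deriv g (u x) • weakGradient U u x) 2
        (volume.restrict U)) ^ s := by
    refine (measure_mono fun x hx => ?_).trans
      (hcheb.trans (ENNReal.rpow_le_rpow hsob hs0.le))
    have h1 : |g (u x)| = 1 := hgδ _ (le_of_lt hx)
    change 1 ≤ ‖g (u x)‖ₑ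
    rw [Real.enorm_eq_ofReal_abs, h1, ENNReal.ofReal_one]
  have hmeas' := ENNReal.toReal_mono (ENNReal.rpow_ne_top_of_nonneg hs0.le
    (ENNReal.mul_ne_top ENNReal.ofReal_ne_top hgW.2.ne)) hmeas
  rw [← ENNReal.toReal_rpow, ENNReal.toReal_mul, ENNReal.toReal_ofReal hγ0] at hmeas'
  set L := (eLpNorm (fun x => deriv g (u x) • weakGradient U u x) 2 (volume.restrict U)).toReal
  have hL0 : 0 ≤ L := ENNReal.toReal_nonneg
  have ha0 : 0 ≤ a := measureReal_nonneg
  have hN0 : 0 ≤ N := ENNReal.toReal_nonneg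
  refine hmeas'.trans ?_
  calc (γ * L) ^ s = (γ ^ 2 * L ^ 2) ^ (s / 2) := by
        rw [← mul_pow, ← Real.rpow_natCast, ← Real.rpow_mul (by positivity)]
        congr 1; push_cast; ring
    _ ≤ (γ ^ 2 * (M / δ * (N * a ^ (1 - 1 / r)))) ^ (s / 2) := by gcongr
    _ = (γ ^ 2 * M * N / δ * a ^ (1 - 1 / r)) ^ (s / 2) := by congr 1; ring
    _ = _ := by
        rw [Real.mul_rpow (by positivity) (by positivity), ← Real.rpow_mul ha0, hs2]
        ring_nf

/-- The `L^∞` bound for weak solutions. -/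
theorem exists_const_eLpNorm_top_le (hd : 3 ≤ d) : ∃ C : ℝ → ℝ → ℝ, (∀ p V : ℝ, 0 < C p V) ∧
    ∀ U : Set 𝔼, IsOpen U → Bornology.IsBounded U →
    ∀ c : 𝔼 → ℝ, (∀ᵐ x ∂(volume.restrict U), 0 ≤ c x) → ∀ p : ℝ, (d : ℝ) < p → ∀ f u : 𝔼 → ℝ,
      MemLp f (ENNReal.ofReal (p * d / (d + p))) (volume.restrict U) → IsWeakSolution U c f u →
      eLpNorm u ∞ (volume.restrict U) ≤ ENNReal.ofReal (C p (volume U).toReal) *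
        eLpNorm f (ENNReal.ofReal (p * d / (d + p))) (volume.restrict U) := by
  have hd3 : (3 : ℝ) ≤ d := by exact_mod_cast hd
  have hd2 : (0 : ℝ) < d - 2 := by linarith
  obtain ⟨M, hM0, hM⟩ := exists_smooth_truncation
  set γ : ℝ := 2 * (d - 1) / (d - 2) with hγ
  let σ : ℝ := d / (d - 2)
  have hσ : 0 < σ := div_pos (by linarith) hd2
  let β : ℝ → ℝ := fun p => σ * (1 - 1 / (p * d / (d + p)))
  -- Stampacchia's threshold divided by the norm of f. The absolute value and the added 1 make it
  -- positive for all real arguments.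
  refine ⟨fun p V => γ ^ 2 * M * (2 ^ (1 + 1 / (β p - 1)) * |V| ^ ((β p - 1) / σ)) + 1,
    fun p V => by positivity, ?_⟩
  intro U hU hb c hc0 p hp f u hf hu
  have : IsFiniteMeasure (volume.restrict U) := ⟨by
    rw [Measure.restrict_apply_univ]; exact hb.measure_lt_top⟩
  have hp0 : 0 < p := by linarith
  have hr : 1 ≤ p * d / (d + p) := by
    rw [one_le_div (by positivity)]; nlinarith
  have hβ : 1 < β p := by
    -- This is where p > d is used: it makes the decay superlinear.
    have e : β p - 1 = (p - d) / (p * (d - 2)) := by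
      simp only [β, σ]; field_simp; ring
    have : 0 < β p - 1 := by rw [e]; exact div_pos (by linarith) (by positivity)
    linarith
  set N := (eLpNorm f (ENNReal.ofReal (p * d / (d + p))) (volume.restrict U)).toReal with hN
  have hN0 : 0 ≤ N := ENNReal.toReal_nonneg
  set V := (volume U).toReal with hV
  have hV0 : 0 ≤ V := ENNReal.toReal_nonneg
  set Q := γ ^ 2 * M * (2 ^ (1 + 1 / (β p - 1)) * |V| ^ ((β p - 1) / σ)) with hQ
  have hQ0 : 0 ≤ Q := by positivity
  -- The slack ε keeps the level D positive even when the norm of f is zero.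
  have hbound : ∀ ε : ℝ, 0 < ε → eLpNorm u ∞ (volume.restrict U) ≤
      ENNReal.ofReal ((Q + 1) * N + ε) := by
    intro ε hε
    have hz := eq_zero_of_stampacchia (a := fun k => (volume.restrict U).real {x | k < |u x|})
      (σ := σ) (β := β p) (K := γ ^ 2 * M * N) (D := (Q + 1) * N + ε) (V := V)
      (fun k => measureReal_nonneg)
      (fun k l hkl => measureReal_mono (fun x hx => lt_of_le_of_lt hkl hx)) hσ hβ (by positivity)
      ?_ (by positivity) ?_ ?_
    · rw [eLpNorm_exponent_top]
      refine eLpNormEssSup_le_of_ae_bound ?_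
      rw [measureReal_eq_zero_iff] at hz
      refine (measure_eq_zero_iff_ae_notMem.1 hz).mono fun x hx => ?_
      exact not_lt.1 hx
    · rw [hV, ← Measure.restrict_apply_univ U]
      exact measureReal_mono (Set.subset_univ _)
    · have : γ ^ 2 * M * N * (2 ^ (1 + 1 / (β p - 1)) * V ^ ((β p - 1) / σ)) = Q * N := by
        rw [hQ, abs_of_nonneg hV0]; ring
      rw [this]
      linarith
    · intro k δ hk hδ
      obtain ⟨g, hg, g0, hg1, hgk, hgδ, hgs, hg', hgM⟩ := hM k δ hk hδ
      exact hu.measure_superlevel_le hd hU hb hc0 hr hf hM0 hδ hg g0 hg1 hgk hgδ hgs hg' hgM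
  have hle : eLpNorm u ∞ (volume.restrict U) ≤ ENNReal.ofReal ((Q + 1) * N) := by
    refine ENNReal.le_of_forall_pos_le_add fun ε hε _ => ?_
    refine (hbound ε hε).trans_eq ?_
    rw [ENNReal.ofReal_add (by positivity) ε.coe_nonneg, ENNReal.ofReal_coe_nnreal]
  refine hle.trans_eq ?_
  rw [ENNReal.ofReal_mul (by positivity), hN, ENNReal.ofReal_toReal hf.2.ne]

/-- The exponent pd/(d+p) increases with p and equals 2d/(d+2) at p = 2 < d; on a set of finite
measure the higher exponent is the stronger. -/
theorem memLp_sobolev_exponent_of_lt (hd : 3 ≤ d) (hb : Bornology.IsBounded U) {f : 𝔼 → ℝ} {p : ℝ}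
    (hp : (d : ℝ) < p) (hf : MemLp f (ENNReal.ofReal (p * d / (d + p))) (volume.restrict U)) :
    MemLp f (ENNReal.ofReal (2 * d / (d + 2))) (volume.restrict U) := by
  have : IsFiniteMeasure (volume.restrict U) := ⟨by
    rw [Measure.restrict_apply_univ]; exact hb.measure_lt_top⟩
  have hd3 : (3 : ℝ) ≤ d := by exact_mod_cast hd
  have hp0 : 0 < p := by linarith
  refine hf.mono_exponent (ENNReal.ofReal_le_ofReal ?_)
  rw [div_le_div_iff₀ (by positivity) (by positivity)]
  nlinarith [mul_nonneg (sq_nonneg (d : ℝ)) (by linarith : (0 : ℝ) ≤ p - 2)]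

end Bounded

/-! ### Assembly of the three claims -/

theorem mainTheorem5 (d : ℕ) (hd : 3 ≤ d) :
    -- the constant of the bound in (iii), a function of `p` and `|U|` only (for the given `d`)
    ∃ C : ℝ → ℝ → ℝ, (∀ p V : ℝ, 0 < C p V) ∧
    ∀ (U : Set (EuclideanSpace ℝ (Fin d))), IsOpen U → Bornology.IsBounded U →
    ∀ (c : EuclideanSpace ℝ (Fin d) → ℝ),
      MemLp c (ENNReal.ofReal (2 * d / (d + 2))) (volume.restrict U) →
      (∀ᵐ x ∂(volume.restrict U), 0 ≤ c x) →
    -- (i)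
    (∀ v : EuclideanSpace ℝ (Fin d) → ℝ, MemH10 U v →
      (∀ φ : EuclideanSpace ℝ (Fin d) → ℝ, IsTestFunction U φ →
        (∫ x in U, inner ℝ (weakGradient U v x) (gradient φ x)) + ∫ x in U, c x * v x * φ x = 0) →
      v =ᵐ[volume.restrict U] 0) ∧
    -- (ii)
    (∀ f : EuclideanSpace ℝ (Fin d) → ℝ,
      MemLp f (ENNReal.ofReal (2 * d / (d + 2))) (volume.restrict U) →
      ∃ u : EuclideanSpace ℝ (Fin d) → ℝ, IsWeakSolution U c f u ∧
        eLpNorm (weakGradient U u) 2 (volume.restrict U) ≤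
          ENNReal.ofReal (2 * (d - 1) / (d - 2)) *
            eLpNorm f (ENNReal.ofReal (2 * d / (d + 2))) (volume.restrict U)) ∧
    -- (iii)
    (∀ p : ℝ, (d : ℝ) < p → ∀ f : EuclideanSpace ℝ (Fin d) → ℝ,
      MemLp f (ENNReal.ofReal (p * d / (d + p))) (volume.restrict U) →
      ∃ u : EuclideanSpace ℝ (Fin d) → ℝ, IsWeakSolution U c f u ∧
        (∀ w : EuclideanSpace ℝ (Fin d) → ℝ, IsWeakSolution U c f w →
          w =ᵐ[volume.restrict U] u) ∧
        eLpNorm (weakGradient U u) 2 (volume.restrict U) ≤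
          ENNReal.ofReal (2 * (d - 1) / (d - 2)) *
            eLpNorm f (ENNReal.ofReal (2 * d / (d + 2))) (volume.restrict U) ∧
        MemLp u ∞ (volume.restrict U) ∧
        eLpNorm u ∞ (volume.restrict U) ≤
          ENNReal.ofReal (C p (volume U).toReal) *
            eLpNorm f (ENNReal.ofReal (p * d / (d + p))) (volume.restrict U)) := by
  obtain ⟨C, hC0, hC⟩ := exists_const_eLpNorm_top_le hd
  refine ⟨C, hC0, fun U hU hb c hc hc0 => ⟨fun v hv heq => ?_, fun f hf => ?_, fun p hp f hf => ?_⟩⟩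
  · exact hv.ae_eq_zero hd hU (hv.integrable_mul hd hU hc) hc0 heq
  · exact exists_isWeakSolution hd hU hb hc hc0 hf
  · obtain ⟨u, hu, hgrad⟩ :=
      exists_isWeakSolution hd hU hb hc hc0 (memLp_sobolev_exponent_of_lt hd hb hp hf)
    have hbd := hC U hU hb c hc0 p hp f u hf hu
    exact ⟨u, hu, fun w hw => hw.ae_eq hd hU hc0 hu, hgrad,
      ⟨hu.1.1.1.1, hbd.trans_lt (ENNReal.mul_lt_top ENNReal.ofReal_lt_top hf.2)⟩, hbd⟩
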